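/- **Setting.** Let $M$ be a compact smooth ($C^\infty$, Hausdorff) manifold without boundary, of finite dimension, endowed with a smooth Riemannian metric. Let $X$ be a $C^1$ vector field on $M$ and let $(X_t)_{t\in\mathbb R}$ be its flow. For $x\in M$ and $I\subset\mathbb R$ write $X_I(x)=\{X_t(x): t\in I\}$ and $\mathrm{orb}(x)=X_{\mathbb R}(x)$. A singularity is a point $x$ with $X(x)=0$; a periodic point is a point $x$ with $X(x)\neq 0$ and $X_t(x)=x$ for some $t>0$. A compact $X$-invariant set $\Lambda\subset M$ is *hyperbolic* if there are a continuous splitting $T_\Lambda M=E^s\oplus\langle X\rangle\oplus E^u$ into $DX_t$-invariant subbundles and a constant $S>0$ such that $\|DX_S(x)|_{E^s_x}\|<\tfrac12$ and $\|DX_{-S}(x)|_{E^u_x}\|<\tfrac12$ for every $x\in\Lambda$ (at a singularity, $\langle X\rangle=0$). A periodic point or a singularity $x$ is hyperbolic if $\mathrm{orb}(x)$ is a hyperbolic set. **Proposition.** Suppose that all periodic orbits and all singularities of $X$ are hyperbolic. Let $f:M\to M$ be a $C^1$ diffeomorphism such that $f\circ X_t=X_t\circ f$ for every $t\in\mathbb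 R$, and suppose that there is a constant $T>0$ such that $f(p)\in X_{[-T,T]}(p)$ for every $p\in M$. Then there exists a continuous function $\tau:M\to\mathbb R$ that is $X$-invariant, i.e. $\tau(X_t(p))=\tau(p)$ for all $t\in\mathbb R$ and $p\in M$, such that $f(p)=X_{\tau(p)}(p)$ for every $p\in M$. -/

import Mathlib

open Set Topology Bundle
open scoped Manifold ContDiff

noncomputable section

namespace VectorFieldFlow

variable {d : ℕ} {M : Type*} [TopologicalSpace M] [ChartedSpace (EuclideanSpace ℝ (Fin d)) M]

/-- The class of `C^1` vector fields: `C^1` sections of the tangent bundle. -/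
def IsC1VectorField [IsManifold (𝓡 d) ∞ M] (X : ∀ x : M, TangentSpace (𝓡 d) x) : Prop :=
  ContMDiff (𝓡 d) (𝓡 d).tangent 1 (fun x ↦ (⟨x, X x⟩ : TangentBundle (𝓡 d) M))

open Classical in
/-- The flow of the vector field `X`: `flow X t x` is the value at time `t` of the integral curve
of `X`, defined on all of `ℝ`, that is at `x` at time `0`. For a `C^1` vector field on a compact
Hausdorff manifold without boundary this curve exists and is unique; the value `x` is used for
other vector fields at points where there is no such curve. -/
def flow (X : ∀ x : M, TangentSpace (𝓡 d) x) (t : ℝ) (x : M) : M :=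
  if h : ∃ γ : ℝ → M, γ 0 = x ∧ IsMIntegralCurve (I := 𝓡 d) γ X then h.choose t else x

/-- The set `X_I(x) = {X_t(x) : t ∈ I}`. -/
def orbitPiece (X : ∀ x : M, TangentSpace (𝓡 d) x) (I : Set ℝ) (x : M) : Set M :=
  (fun t ↦ flow X t x) '' I

/-- The orbit of `x`. -/
def orbit (X : ∀ x : M, TangentSpace (𝓡 d) x) (x : M) : Set M :=
  orbitPiece X univ x

/-- The singularities (zeros) of `X`. -/
def singularities (X : ∀ x : M, TangentSpace (𝓡 d) x) : Set M :=
  {x | X x = 0}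

/-- The non-singular periodic points of `X`. -/
def periodicPoints (X : ∀ x : M, TangentSpace (𝓡 d) x) : Set M :=
  {x | X x ≠ 0 ∧ ∃ t : ℝ, 0 < t ∧ flow X t x = x}

/-- The derivative `DX_t(x) : T_x M → T_{X_t(x)} M` of the time `t` map of the flow. -/
def flowDeriv (X : ∀ x : M, TangentSpace (𝓡 d) x) (t : ℝ) (x : M) :
    TangentSpace (𝓡 d) x →L[ℝ] TangentSpace (𝓡 d) (flow X t x) :=
  mfderiv (𝓡 d) (𝓡 d) (flow X t) x

/-- `E` restricts to a continuous subbundle of `TM` over `Λ`: near each point of `Λ`, it has a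
frame of continuous sections. Only the values of `E` at points of `Λ` matter. -/
def IsContinuousSubbundleOn [IsManifold (𝓡 d) ∞ M]
    (E : ∀ x : M, Submodule ℝ (TangentSpace (𝓡 d) x)) (Λ : Set M) : Prop :=
  ∀ x ∈ Λ, ∃ U : Set M, IsOpen U ∧ x ∈ U ∧
    ∃ (k : ℕ) (s : Fin k → ∀ y : M, TangentSpace (𝓡 d) y),
      (∀ i, ContinuousOn (fun y ↦ (⟨y, s i y⟩ : TangentBundle (𝓡 d) M)) (Λ ∩ U)) ∧
      ∀ y ∈ Λ ∩ U, LinearIndependent ℝ (fun i ↦ s i y) ∧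
        Submodule.span ℝ (range fun i ↦ s i y) = E y

/-- `Λ` is a hyperbolic set of `X`: it is compact and invariant, and there is a continuous
splitting `T_Λ M = E^s ⊕ ⟨X⟩ ⊕ E^u` into `DX_t`-invariant subbundles such that, for some `T > 0`,
`‖DX_T|E^s‖ < 1/2` and `‖DX_{-T}|E^u‖ < 1/2` at every point of `Λ`. The norms are the operator norms
for the Riemannian metric. At a singularity the summand `⟨X⟩` is zero. -/
def IsHyperbolicSet [IsManifold (𝓡 d) ∞ M]
    [RiemannianBundle (fun x : M ↦ TangentSpace (𝓡 d) x)]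
    (X : ∀ x : M, TangentSpace (𝓡 d) x) (Λ : Set M) : Prop :=
  IsCompact Λ ∧ (∀ t : ℝ, flow X t '' Λ = Λ) ∧
  ∃ Es Eu : ∀ x : M, Submodule ℝ (TangentSpace (𝓡 d) x),
    IsContinuousSubbundleOn Es Λ ∧ IsContinuousSubbundleOn Eu Λ ∧
    (∀ x ∈ Λ, DirectSum.IsInternal ![Es x, Submodule.span ℝ {X x}, Eu x]) ∧
    (∀ x ∈ Λ, ∀ t : ℝ,
      (Es x).map (flowDeriv X t x).toLinearMap = Es (flow X t x) ∧
      (Eu x).map (flowDeriv X t x).toLinearMap = Eu (flow X t x)) ∧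
    ∃ T : ℝ, 0 < T ∧ ∀ x ∈ Λ,
      ‖(flowDeriv X T x).comp (Es x).subtypeL‖ < 1 / 2 ∧
      ‖(flowDeriv X (-T) x).comp (Eu x).subtypeL‖ < 1 / 2

/-- All periodic orbits and all singularities of `X` are hyperbolic. -/
def AllCriticalOrbitsHyperbolic [IsManifold (𝓡 d) ∞ M]
    [RiemannianBundle (fun x : M ↦ TangentSpace (𝓡 d) x)]
    (X : ∀ x : M, TangentSpace (𝓡 d) x) : Prop :=
  ∀ x ∈ periodicPoints X ∪ singularities X, IsHyperbolicSet X (orbit X x)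

/-- The `C^1` diffeomorphism centralizer of `X`. -/
def diffCentralizer (X : ∀ x : M, TangentSpace (𝓡 d) x) : Set (M ≃ₘ^1⟮𝓡 d, 𝓡 d⟯ M) :=
  {f | ∀ (t : ℝ) (x : M), f (flow X t x) = flow X t (f x)}

/-- A function is `X`-invariant if it is constant along the flow. -/
def IsInvariantFunction (X : ∀ x : M, TangentSpace (𝓡 d) x) (τ : M → ℝ) : Prop :=
  ∀ (t : ℝ) (x : M), τ (flow X t x) = τ x

end VectorFieldFlow

end

/-! The displacement times `t ∈ [-T, T]` with `f q = X_t(q)` need not be unique, so the point is to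
show that they have a limit as `q` tends to `p` from outside the orbit of `p`. Such a limit is an
`IsLimitTime`. If every point has one, choose one per orbit: the resulting function is constant
along orbits, and off the orbit of `p` its values converge to its value at `p`, so it is continuous.

At a point with no nonzero return time, compactness of `[-T, T]` suffices, since every accumulation
time `t₀` satisfies `f p = X_{t₀}(p)` and is thereby determined.

At a periodic point or a singularity, let `f p = X_c(p)` and `g = X_{-c} ∘ f`, which fixes `p` and
commutes with the flow. If `q n → p` in the direction `v` and the times for `g` tend to a return
time `h`, then `Dg v = DX_h v` modulo the flow direction (`modelDeriv_sub_mem_span`). So each `v`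
comes with some return time. Hyperbolicity says that `DX_h`, for a return time `h ≠ 0`, has no fixed
vector modulo the flow direction (`mem_span_of_isHyperbolicSet`), and linear algebra then forces one
return time `a` to serve all `v` (`exists_forall_sub_mem`). Conversely, any accumulation time must
agree with `a + c`: after sliding the approaching points along their orbits into a hyperplane
transverse to `X` (`exists_transversal`), they have a limit direction off the flow direction, and
this direction determines the time.

Smooth dependence of the flow on initial points is replaced by a Lipschitz estimate in charts
(`exists_flow_lipschitz`). Derivatives are read in the model space, so that at a fixed point they
are endomorphisms without transport between fibres. -/

noncomputable section

namespace VectorFieldFlow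

open Filter Metric
open scoped NNReal

/-! ### Integral curves in a chart and their Lipschitz dependence on the initial point. -/

section LocalField

variable {d : ℕ} {M : Type*} [TopologicalSpace M] [ChartedSpace (EuclideanSpace ℝ (Fin d)) M]
  [IsManifold (𝓡 d) ∞ M] {X : ∀ x : M, TangentSpace (𝓡 d) x}

/-- The vector field `X` with its values read in the model space. -/
def modelField (X : ∀ x : M, TangentSpace (𝓡 d) x) (x : M) : EuclideanSpace ℝ (Fin d) := X x

/-- The vector field `X` read in the preferred chart at `p`. -/
def chartField (X : ∀ x : M, TangentSpace (𝓡 d) x) (p : M) (x : EuclideanSpace ℝ (Fin d)) :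
    EuclideanSpace ℝ (Fin d) :=
  tangentCoordChange (𝓡 d) ((extChartAt (𝓡 d) p).symm x) p ((extChartAt (𝓡 d) p).symm x)
    (modelField X ((extChartAt (𝓡 d) p).symm x))

theorem chartField_self (p : M) : chartField X p (extChartAt (𝓡 d) p p) = modelField X p := by
  unfold chartField
  rw [extChartAt_to_inv (I := 𝓡 d) p]
  exact tangentCoordChange_self (mem_extChartAt_source (I := 𝓡 d) p)

theorem contDiffAt_chartField (hX : IsC1VectorField X) (p : M) :
    ContDiffAt ℝ 1 (chartField X p) (extChartAt (𝓡 d) p p) := by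
  have hv := hX p
  rw [contMDiffAt_iff] at hv
  exact (hv.2.contDiffAt (by simp)).snd

/-- A solution of the equation in the chart gives an integral curve on the manifold. -/
theorem hasMFDerivAt_symm_comp {p : M} {c : ℝ → EuclideanSpace ℝ (Fin d)} {t : ℝ}
    (hc : HasDerivAt c (chartField X p (c t)) t) (ht : c t ∈ (extChartAt (𝓡 d) p).target) :
    HasMFDerivAt 𝓘(ℝ, ℝ) (𝓡 d) ((extChartAt (𝓡 d) p).symm ∘ c) t
      ((1 : ℝ →L[ℝ] ℝ).smulRight (X ((extChartAt (𝓡 d) p).symm (c t)))) := by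
  set y : M := (extChartAt (𝓡 d) p).symm (c t) with hy
  have h1 : y ∈ (extChartAt (𝓡 d) p).source := (extChartAt (𝓡 d) p).map_target ht
  have h2 := mem_extChartAt_source (I := 𝓡 d) y
  have key : tangentCoordChange (𝓡 d) p y y (chartField X p (c t)) = modelField X y := by
    unfold chartField
    rw [← hy, tangentCoordChange_comp ⟨⟨h2, h1⟩, h2⟩]
    exact tangentCoordChange_self h2
  have h3 := hasFDerivWithinAt_tangentCoordChange (I := 𝓡 d) (x := p) (y := y) (z := y) ⟨h1, h2⟩
  rw [(extChartAt (𝓡 d) p).right_inv ht] at h3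
  have h4 := (h3.hasFDerivAt (by simp)).comp_hasDerivAt t hc
  have h5 : HasFDerivAt ((extChartAt (𝓡 d) y ∘ (extChartAt (𝓡 d) p).symm) ∘ c)
      ((1 : ℝ →L[ℝ] ℝ).smulRight (modelField X y)) t := by
    refine h4.hasFDerivAt.congr_fderiv ?_
    rw [key]
    exact ContinuousLinearMap.ext fun a ↦ rfl
  exact ⟨(continuousAt_extChartAt_symm'' ht).comp hc.continuousAt,
    h5.hasFDerivWithinAt (s := range 𝓘(ℝ, ℝ))⟩

/-- An integral curve on the manifold solves the equation in the chart. -/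
theorem hasDerivAt_chart_comp {p : M} {γ : ℝ → M} {t : ℝ}
    (hγ : HasMFDerivAt 𝓘(ℝ, ℝ) (𝓡 d) γ t ((1 : ℝ →L[ℝ] ℝ).smulRight (X (γ t))))
    (ht : γ t ∈ (extChartAt (𝓡 d) p).source) :
    HasDerivAt (fun s ↦ extChartAt (𝓡 d) p (γ s)) (chartField X p (extChartAt (𝓡 d) p (γ t))) t := by
  have hsrc := ht
  rw [extChartAt_source] at hsrc
  have h1 := HasMFDerivAt.comp t (hasMFDerivAt_extChartAt (I := 𝓡 d) hsrc) hγ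
  rw [mfderiv_chartAt_eq_tangentCoordChange hsrc] at h1
  have h2 : HasFDerivAt (fun s ↦ extChartAt (𝓡 d) p (γ s))
      ((tangentCoordChange (𝓡 d) (γ t) p (γ t)).comp
        ((1 : ℝ →L[ℝ] ℝ).smulRight (modelField X (γ t)))) t := h1.hasFDerivAt
  refine h2.hasDerivAt.congr_deriv ?_
  unfold chartField
  rw [(extChartAt (𝓡 d) p).left_inv ht, ContinuousLinearMap.comp_apply,
    ContinuousLinearMap.smulRight_apply, one_apply_eq_self, one_smul]

/-- The local flow in the chart at `p`, Lipschitz in the initial point. -/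
theorem exists_local_solution (hX : IsC1VectorField X) (p : M) :
    ∃ ε > 0, ∃ U ∈ 𝓝 p, ∃ L : ℝ, 0 ≤ L ∧
      ∃ α : EuclideanSpace ℝ (Fin d) → ℝ → EuclideanSpace ℝ (Fin d),
        (∀ q ∈ U, q ∈ (extChartAt (𝓡 d) p).source ∧
          α (extChartAt (𝓡 d) p q) 0 = extChartAt (𝓡 d) p q ∧
          ∀ t ∈ Ioo (-ε) ε, HasDerivAt (α (extChartAt (𝓡 d) p q))
            (chartField X p (α (extChartAt (𝓡 d) p q) t)) t ∧
            α (extChartAt (𝓡 d) p q) t ∈ (extChartAt (𝓡 d) p).target) ∧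
        ∀ q ∈ U, ∀ q' ∈ U, ∀ t ∈ Ioo (-ε) ε,
          ‖α (extChartAt (𝓡 d) p q) t - α (extChartAt (𝓡 d) p q') t‖ ≤
            L * ‖extChartAt (𝓡 d) p q - extChartAt (𝓡 d) p q'‖ := by
  set φ := extChartAt (𝓡 d) p with hφ
  obtain ⟨ε, hε, a, r, _, _, hr, hpl⟩ :=
    IsPicardLindelof.of_contDiffAt_one (contDiffAt_chartField hX p)
  obtain ⟨α, hα, L, hL⟩ :=
    (hpl 0).exists_forall_mem_closedBall_eq_hasDerivWithinAt_lipschitzOnWith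
  simp only [zero_sub, zero_add] at hα hL
  have hcont : ContinuousOn (Function.uncurry α) (closedBall (φ p) r ×ˢ Icc (-ε) ε) :=
    continuousOn_prod_of_continuousOn_lipschitzOnWith _ L
      (fun x hx ↦ HasDerivWithinAt.continuousOn (hα x hx).2) hL
  have hr' : (0 : ℝ) < r := by exact_mod_cast hr
  have hnhds : closedBall (φ p) (r : ℝ) ×ˢ Icc (-ε) ε ∈ 𝓝 (φ p, (0 : ℝ)) :=
    prod_mem_nhds (closedBall_mem_nhds _ hr') (Icc_mem_nhds (by linarith) hε)
  have hat : ContinuousAt (Function.uncurry α) (φ p, 0) := hcont.continuousAt hnhds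
  have h0 : Function.uncurry α (φ p, 0) = φ p := (hα (φ p) (mem_closedBall_self hr'.le)).1
  have htar : φ.target ∈ 𝓝 (Function.uncurry α (φ p, 0)) := by
    rw [h0]; exact extChartAt_target_mem_nhds p
  have hmem : ∀ᶠ z : EuclideanSpace ℝ (Fin d) × ℝ in 𝓝 (φ p, (0 : ℝ)),
      Function.uncurry α z ∈ φ.target := hat htar
  rw [nhds_prod_eq] at hmem
  obtain ⟨P, hP, Q, hQ, hPQ⟩ := eventually_prod_iff.1 hmem
  obtain ⟨δ, hδ, hδQ⟩ := Metric.eventually_nhds_iff_ball.1 hQ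
  have hcφ : ContinuousAt φ p := continuousAt_extChartAt p
  have hU : ∀ᶠ q in 𝓝 p, q ∈ φ.source ∧ φ q ∈ closedBall (φ p) (r : ℝ) ∧ P (φ q) :=
    (show ∀ᶠ q in 𝓝 p, q ∈ φ.source from extChartAt_source_mem_nhds p).and
      ((hcφ.eventually_mem (closedBall_mem_nhds _ hr')).and (hcφ.eventually hP))
  refine ⟨min ε δ, lt_min hε hδ, _, hU, L, L.2, α, ?_, ?_⟩
  · rintro q ⟨hq1, hq2, hq3⟩
    refine ⟨hq1, (hα _ hq2).1, fun t ht ↦ ⟨?_, ?_⟩⟩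
    · have h1 : -ε < t := by have := ht.1; have := min_le_left ε δ; linarith
      have h2 : t < ε := ht.2.trans_le (min_le_left _ _)
      exact ((hα _ hq2).2 t ⟨h1.le, h2.le⟩).hasDerivAt (Icc_mem_nhds h1 h2)
    · refine hPQ hq3 (hδQ t ?_)
      rw [Real.ball_eq_Ioo]
      have := min_le_right ε δ
      exact ⟨by linarith [ht.1], by linarith [ht.2]⟩
  · rintro q ⟨-, hq, -⟩ q' ⟨-, hq', -⟩ t ht
    have := min_le_left ε δ
    have h := (hL t ⟨by linarith [ht.1], by linarith [ht.2]⟩).dist_le_mul _ hq _ hq'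
    simpa only [dist_eq_norm] using h

end LocalField

/-- Take the smallest constant over a finite subcover. This turns local existence times into uniform
ones. -/
theorem exists_uniform_pos {M : Type*} [TopologicalSpace M] [CompactSpace M] {P : ℝ → M → Prop}
    (hanti : ∀ ⦃ε δ : ℝ⦄ ⦃x : M⦄, δ ≤ ε → P ε x → P δ x)
    (h : ∀ p : M, ∃ ε > 0, ∃ U ∈ 𝓝 p, ∀ x ∈ U, P ε x) : ∃ ε > 0, ∀ x, P ε x := by
  classical
  choose ε hε U hU h using h
  obtain ⟨s, hs⟩ := CompactSpace.elim_nhds_subcover U hU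
  have hne : ∀ x : M, ∃ p ∈ s, x ∈ U p := fun x ↦ by
    simpa using (hs ▸ mem_univ x : x ∈ ⋃ p ∈ s, U p)
  obtain ⟨δ, hδ, hδs⟩ : ∃ δ > 0, ∀ p ∈ s, δ ≤ ε p := by
    clear hs hne
    induction s using Finset.induction_on with
    | empty => exact ⟨1, one_pos, by simp⟩
    | insert a s _ ih =>
      obtain ⟨δ, hδ, h⟩ := ih
      refine ⟨min δ (ε a), lt_min hδ (hε a), fun p hp ↦ ?_⟩
      rcases Finset.mem_insert.1 hp with rfl | hp
      · exact min_le_right _ _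
      · exact (min_le_left _ _).trans (h p hp)
  refine ⟨δ, hδ, fun x ↦ ?_⟩
  obtain ⟨p, hp, hx⟩ := hne x
  exact hanti (hδs p hp) (h p x hx)

/-! ### The global flow: group law and joint continuity. -/

section GlobalFlow

variable {d : ℕ} {M : Type*} [TopologicalSpace M] [CompactSpace M]
  [ChartedSpace (EuclideanSpace ℝ (Fin d)) M] [IsManifold (𝓡 d) ∞ M]
  {X : ∀ x : M, TangentSpace (𝓡 d) x}

theorem exists_local_integralCurve (hX : IsC1VectorField X) :
    ∃ ε > 0, ∀ x : M, ∃ γ : ℝ → M, γ 0 = x ∧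
      IsMIntegralCurveOn (I := 𝓡 d) γ X (Ioo (-ε) ε) := by
  refine exists_uniform_pos (P := fun ε x ↦ ∃ γ : ℝ → M, γ 0 = x ∧
    IsMIntegralCurveOn (I := 𝓡 d) γ X (Ioo (-ε) ε)) ?_ fun p ↦ ?_
  · rintro ε δ x hδ ⟨γ, h0, hγ⟩
    exact ⟨γ, h0, hγ.mono (Ioo_subset_Ioo (by linarith) hδ)⟩
  · obtain ⟨ε, hε, U, hU, L, -, α, hα, -⟩ := exists_local_solution hX p
    refine ⟨ε, hε, U, hU, fun x hx ↦ ?_⟩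
    obtain ⟨hx1, hx2, hx3⟩ := hα x hx
    refine ⟨(extChartAt (𝓡 d) p).symm ∘ α (extChartAt (𝓡 d) p x), ?_, fun t ht ↦ ?_⟩
    · rw [Function.comp_apply, hx2, PartialEquiv.left_inv _ hx1]
    · exact (hasMFDerivAt_symm_comp (hx3 t ht).1 (hx3 t ht).2).hasMFDerivWithinAt

variable [T2Space M]

theorem exists_integralCurve (hX : IsC1VectorField X) (x : M) :
    ∃ γ : ℝ → M, γ 0 = x ∧ IsMIntegralCurve (I := 𝓡 d) γ X := by
  obtain ⟨ε, hε, h⟩ := exists_local_integralCurve hX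
  exact exists_isMIntegralCurve_of_isMIntegralCurveOn hX hε h x

theorem isMIntegralCurve_flow (hX : IsC1VectorField X) (x : M) :
    IsMIntegralCurve (I := 𝓡 d) (fun t ↦ flow X t x) X := by
  have h := exists_integralCurve hX x
  simp only [flow, dif_pos h]
  exact h.choose_spec.2

theorem flow_zero (hX : IsC1VectorField X) (x : M) : flow X 0 x = x := by
  have h := exists_integralCurve hX x
  simp only [flow, dif_pos h]
  exact h.choose_spec.1

theorem flow_add (hX : IsC1VectorField X) (s t : ℝ) (x : M) :
    flow X (s + t) x = flow X s (flow X t x) := by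
  have h1 := (isMIntegralCurve_flow hX x).comp_add t
  have h2 := isMIntegralCurve_flow hX (flow X t x)
  have h := isMIntegralCurve_Ioo_eq_of_contMDiff_boundaryless (t₀ := 0) hX h1 h2
    (by simp [flow_zero hX])
  exact congrFun h s

theorem flow_neg_flow (hX : IsC1VectorField X) (t : ℝ) (x : M) :
    flow X (-t) (flow X t x) = x := by
  rw [← flow_add hX, neg_add_cancel, flow_zero hX]

theorem flow_comm (hX : IsC1VectorField X) (s t : ℝ) (x : M) :
    flow X s (flow X t x) = flow X t (flow X s x) := by
  rw [← flow_add hX, add_comm, flow_add hX]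

theorem flow_of_singular (hX : IsC1VectorField X) {x : M} (hx : X x = 0) (t : ℝ) :
    flow X t x = x := by
  have h := isMIntegralCurve_Ioo_eq_of_contMDiff_boundaryless (t₀ := 0) hX
    (isMIntegralCurve_flow hX x) (isMIntegralCurve_const hx) (flow_zero hX x)
  exact congrFun h t

/-- Near `p` and for small times the flow stays in the chart at `p`, and it is Lipschitz there. -/
theorem exists_flow_lipschitz (hX : IsC1VectorField X) (p : M) :
    ∃ ε > 0, ∃ U ∈ 𝓝 p, ∃ L : ℝ, 0 ≤ L ∧
      (∀ q ∈ U, ∀ t ∈ Ioo (-ε) ε, flow X t q ∈ (extChartAt (𝓡 d) p).source) ∧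
      ∀ q ∈ U, ∀ q' ∈ U, ∀ t ∈ Ioo (-ε) ε,
        ‖extChartAt (𝓡 d) p (flow X t q) - extChartAt (𝓡 d) p (flow X t q')‖ ≤
          L * ‖extChartAt (𝓡 d) p q - extChartAt (𝓡 d) p q'‖ := by
  obtain ⟨ε, hε, U, hU, L, hL, α, hα, hlip⟩ := exists_local_solution hX p
  have heq : ∀ q ∈ U, ∀ t ∈ Ioo (-ε) ε,
      flow X t q = (extChartAt (𝓡 d) p).symm (α (extChartAt (𝓡 d) p q) t) := by
    intro q hq t ht
    obtain ⟨hq1, hq2, hq3⟩ := hα q hq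
    have hγ : IsMIntegralCurveOn (I := 𝓡 d)
        ((extChartAt (𝓡 d) p).symm ∘ α (extChartAt (𝓡 d) p q)) X (Ioo (-ε) ε) :=
      fun t ht ↦ (hasMFDerivAt_symm_comp (hq3 t ht).1 (hq3 t ht).2).hasMFDerivWithinAt
    refine isMIntegralCurveOn_Ioo_eqOn_of_contMDiff_boundaryless (t₀ := 0)
      ⟨by linarith, hε⟩ hX ((isMIntegralCurve_flow hX q).isMIntegralCurveOn _) hγ ?_ ht
    rw [flow_zero hX, Function.comp_apply, hq2, PartialEquiv.left_inv _ hq1]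
  have heq' : ∀ q ∈ U, ∀ t ∈ Ioo (-ε) ε,
      extChartAt (𝓡 d) p (flow X t q) = α (extChartAt (𝓡 d) p q) t := by
    intro q hq t ht
    rw [heq q hq t ht, PartialEquiv.right_inv _ ((hα q hq).2.2 t ht).2]
  refine ⟨ε, hε, U, hU, L, hL, fun q hq t ht ↦ ?_, fun q hq q' hq' t ht ↦ ?_⟩
  · rw [heq q hq t ht]
    exact (extChartAt (𝓡 d) p).map_target ((hα q hq).2.2 t ht).2
  · rw [heq' q hq t ht, heq' q' hq' t ht]
    exact hlip q hq q' hq' t ht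

theorem continuous_flow_time (hX : IsC1VectorField X) (x : M) : Continuous fun t ↦ flow X t x :=
  (isMIntegralCurve_flow hX x).continuous

theorem continuousAt_flow_zero (hX : IsC1VectorField X) (p : M) :
    ContinuousAt (fun z : ℝ × M ↦ flow X z.1 z.2) (0, p) := by
  obtain ⟨ε, hε, U, hU, L, hL, hsrc, hlip⟩ := exists_flow_lipschitz hX p
  set φ := extChartAt (𝓡 d) p with hφ
  have hpU : p ∈ U := mem_of_mem_nhds hU
  have hloc : ∀ᶠ z : ℝ × M in 𝓝 (0, p), z.1 ∈ Ioo (-ε) ε ∧ z.2 ∈ U :=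
    prod_mem_nhds (Ioo_mem_nhds (by linarith) hε) hU
  have h1 : Tendsto (fun z : ℝ × M ↦ φ (flow X z.1 p)) (𝓝 (0, p)) (𝓝 (φ p)) := by
    have hc : ContinuousAt (fun t ↦ φ (flow X t p)) 0 := by
      refine ContinuousAt.comp (g := φ) ?_ (continuous_flow_time hX p).continuousAt
      rw [flow_zero hX]
      exact continuousAt_extChartAt p
    have : Tendsto (fun t ↦ φ (flow X t p)) (𝓝 0) (𝓝 (φ p)) := by
      simpa [ContinuousAt, flow_zero hX] using hc
    exact this.comp (continuous_fst.tendsto' _ _ rfl)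
  -- Space and time are separated: the Lipschitz bound controls the change of initial point, and
  -- continuity of the orbit of `p` controls the rest.
  have h2 : Tendsto (fun z : ℝ × M ↦ φ (flow X z.1 z.2) - φ (flow X z.1 p)) (𝓝 (0, p))
      (𝓝 0) := by
    have h3 : Tendsto (fun z : ℝ × M ↦ L * ‖φ z.2 - φ p‖) (𝓝 (0, p)) (𝓝 0) := by
      have : Tendsto (fun z : ℝ × M ↦ φ z.2) (𝓝 (0, p)) (𝓝 (φ p)) :=
        (continuousAt_extChartAt (I := 𝓡 d) p).tendsto.comp (continuous_snd.tendsto' _ _ rfl)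
      simpa using ((this.sub_const (φ p)).norm.const_mul L)
    refine squeeze_zero_norm' ?_ h3
    filter_upwards [hloc] with z hz
    exact hlip _ hz.2 _ hpU _ hz.1
  have h4 : Tendsto (fun z : ℝ × M ↦ φ (flow X z.1 z.2)) (𝓝 (0, p)) (𝓝 (φ p)) := by
    simpa using h2.add h1
  have h5 : Tendsto (fun z : ℝ × M ↦ φ.symm (φ (flow X z.1 z.2))) (𝓝 (0, p)) (𝓝 p) := by
    have := (continuousAt_extChartAt_symm (I := 𝓡 d) p).tendsto.comp h4
    rwa [extChartAt_to_inv (I := 𝓡 d) p] at this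
  rw [ContinuousAt, flow_zero hX]
  refine h5.congr' ?_
  filter_upwards [hloc] with z hz
  exact φ.left_inv (hsrc _ hz.2 _ hz.1)

/-- Small times are handled by the Lipschitz estimate, uniformly over the compact manifold; an
arbitrary time `t` is `n` steps of length `t / n`. -/
theorem continuous_flow_space (hX : IsC1VectorField X) (t : ℝ) : Continuous (flow X t) := by
  obtain ⟨ε, hε, hsmall⟩ : ∃ ε > 0, ∀ q : M, ∀ s ∈ Ioo (-ε) ε, ContinuousAt (flow X s) q := by
    refine exists_uniform_pos (P := fun ε q ↦ ∀ s ∈ Ioo (-ε) ε, ContinuousAt (flow X s) q) ?_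
      fun p ↦ ?_
    · exact fun ε δ x hδ h s hs ↦ h s ⟨by linarith [hs.1], by linarith [hs.2]⟩
    obtain ⟨ε, hε, U, hU, L, hL, hsrc, hlip⟩ := exists_flow_lipschitz hX p
    set φ := extChartAt (𝓡 d) p with hφ
    refine ⟨ε, hε, interior U ∩ φ.source,
      inter_mem (interior_mem_nhds.2 hU) (extChartAt_source_mem_nhds p), fun q hq s hs ↦ ?_⟩
    have hqU : q ∈ U := interior_subset hq.1
    have hev : ∀ᶠ q' in 𝓝 q, q' ∈ U := mem_interior_iff_mem_nhds.1 hq.1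
    have h1 : Tendsto (fun q' ↦ φ (flow X s q')) (𝓝 q) (𝓝 (φ (flow X s q))) := by
      rw [tendsto_iff_norm_sub_tendsto_zero]
      have h3 : Tendsto (fun q' ↦ L * ‖φ q' - φ q‖) (𝓝 q) (𝓝 0) := by
        have : Tendsto φ (𝓝 q) (𝓝 (φ q)) := continuousAt_extChartAt' hq.2
        simpa using ((this.sub_const (φ q)).norm.const_mul L)
      refine squeeze_zero' (Eventually.of_forall fun _ ↦ norm_nonneg _) ?_ h3
      filter_upwards [hev] with q' hq'
      exact hlip _ hq' _ hqU _ hs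
    have h2 := (continuousAt_extChartAt_symm' (hsrc q hqU s hs)).tendsto.comp h1
    rw [φ.left_inv (hsrc q hqU s hs)] at h2
    refine Tendsto.congr' ?_ h2
    filter_upwards [hev] with q' hq'
    exact φ.left_inv (hsrc _ hq' _ hs)
  have hit : ∀ (n : ℕ) (s : ℝ), s ∈ Ioo (-ε) ε → Continuous (flow X (n * s)) := by
    intro n s hs
    induction n with
    | zero =>
      have : flow X ((0 : ℕ) * s) = (id : M → M) := by
        funext x
        simp [flow_zero hX]
      rw [this]
      exact continuous_id
    | succ n ih =>
      have : flow X ((n + 1 : ℕ) * s) = flow X s ∘ flow X (n * s) := by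
        funext x
        rw [Function.comp_apply, ← flow_add hX]
        push_cast
        ring_nf
      rw [this]
      exact (continuous_iff_continuousAt.2 fun q ↦ hsmall q s hs).comp ih
  obtain ⟨n, hn⟩ := exists_nat_gt (|t| / ε)
  have hn0 : (0 : ℝ) < n := lt_of_le_of_lt (by positivity) hn
  have hts : t / n ∈ Ioo (-ε) ε := by
    rw [mem_Ioo, ← abs_lt, abs_div, Nat.abs_cast, div_lt_iff₀ hn0]
    rwa [div_lt_iff₀ hε, mul_comm] at hn
  have := hit n (t / n) hts
  rwa [mul_div_cancel₀ _ hn0.ne'] at this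

theorem continuous_flow (hX : IsC1VectorField X) :
    Continuous fun z : ℝ × M ↦ flow X z.1 z.2 := by
  refine continuous_iff_continuousAt.2 fun ⟨t, p⟩ ↦ ?_
  have h : (fun z : ℝ × M ↦ flow X z.1 z.2) =
      (fun z : ℝ × M ↦ flow X z.1 z.2) ∘ fun z : ℝ × M ↦ (z.1 - t, flow X t z.2) := by
    funext z
    simp [← flow_add hX]
  rw [h]
  refine ContinuousAt.comp ?_ ?_
  · simpa using continuousAt_flow_zero hX (flow X t p)
  · exact ((continuous_fst.sub continuous_const).prodMk
      ((continuous_flow_space hX t).comp continuous_snd)).continuousAt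

end GlobalFlow

/-! ### Linear algebra modulo the flow direction, and vanishing of contracted periodic functions. -/

section Algebra

/-- Let `G` commute with a group `Φ` of linear maps which, modulo `L`, have no fixed vectors.
If `G` agrees modulo `L` with some `Φ h` on each vector, it agrees with one `Φ h` on all. -/
theorem exists_forall_sub_mem {V : Type*} [AddCommGroup V] [Module ℝ V] (L : Submodule ℝ V)
    (H : Set ℝ) (Φ : ℝ → V →ₗ[ℝ] V) (G : V →ₗ[ℝ] V)
    (hHsub : ∀ a ∈ H, ∀ b ∈ H, a - b ∈ H)
    (hΦ : ∀ a ∈ H, ∀ b ∈ H, ∀ v, Φ a (Φ b v) = Φ (a + b) v)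
    (hΦ0 : ∀ v, Φ 0 v = v)
    (hL : ∀ a ∈ H, ∀ v ∈ L, Φ a v ∈ L) (hGL : ∀ v ∈ L, G v ∈ L)
    (hcomm : ∀ a ∈ H, ∀ v, G (Φ a v) = Φ a (G v))
    (hfix : ∀ a ∈ H, a ≠ 0 → ∀ v, Φ a v - v ∈ L → v ∈ L)
    {K : Set ℝ} (hK : K ⊆ H) (hex : ∀ v, ∃ a ∈ K, G v - Φ a v ∈ L) (hKne : L ≠ ⊤) :
    ∃ a ∈ K, ∀ v, G v - Φ a v ∈ L := by
  have hinj : ∀ a ∈ H, ∀ b ∈ H, ∀ v, Φ a v - Φ b v ∈ L → v ∉ L → a = b := by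
    intro a ha b hb v hv hvL
    by_contra hab
    have h0 : (0 : ℝ) ∈ H := by simpa using hHsub a ha a ha
    have hnb : -b ∈ H := by simpa using hHsub 0 h0 b hb
    refine hvL (hfix (a - b) (hHsub a ha b hb) (sub_ne_zero.2 hab) v ?_)
    have := hL (-b) hnb _ hv
    rw [map_sub, hΦ _ hnb _ ha, hΦ _ hnb _ hb, neg_add_cancel, hΦ0] at this
    rwa [sub_eq_neg_add a b]
  obtain ⟨v₀, hv₀⟩ : ∃ v, v ∉ L := by
    by_contra! h
    exact hKne (eq_top_iff.2 fun v _ ↦ h v)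
  obtain ⟨a, haK, hav⟩ := hex v₀
  have ha := hK haK
  refine ⟨a, haK, fun w ↦ ?_⟩
  by_cases hw : w ∈ L
  · exact L.sub_mem (hGL w hw) (hL a ha w hw)
  obtain ⟨b, hbK, hbw⟩ := hex w
  have hb := hK hbK
  obtain ⟨c, hcK, hcw⟩ := hex (v₀ + w)
  have hc := hK hcK
  by_contra hcon
  have hab : a ≠ b := fun h ↦ hcon (h ▸ hbw)
  have hinv : ∀ e ∈ H, ∀ h ∈ H, ∀ v, G v - Φ e v ∈ L → G (Φ h v) - Φ e (Φ h v) ∈ L := by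
    intro e he h hh v hv
    have := hL h hh _ hv
    rwa [map_sub, ← hcomm h hh, hΦ _ hh _ he, add_comm, ← hΦ _ he _ hh] at this
  -- Additivity of `G` gives `z ≡ -z'` modulo `L`, while `G` acts as `Φ a` on `z` and as `Φ b` on
  -- `z'`. So `Φ a` and `Φ b` agree on `z` modulo `L`; since `a ≠ b`, both `z` and `z'` lie in `L`,
  -- whence `a = c = b`.
  set z := Φ a v₀ - Φ c v₀ with hz
  set z' := Φ b w - Φ c w with hz'
  have hzz : z + z' ∈ L := by
    have h1 := L.sub_mem (L.sub_mem hcw hav) hbw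
    have h2 : z + z' = G (v₀ + w) - Φ c (v₀ + w) - (G v₀ - Φ a v₀) - (G w - Φ b w) := by
      rw [hz, hz', map_add, map_add]; abel
    rwa [h2]
  have hza : G z - Φ a z ∈ L := by
    have := L.sub_mem (hinv a ha a ha v₀ hav) (hinv a ha c hc v₀ hav)
    convert this using 1
    rw [hz, map_sub, map_sub]; abel
  have hzb' : G z' - Φ b z' ∈ L := by
    have := L.sub_mem (hinv b hb b hb w hbw) (hinv b hb c hc w hbw)
    convert this using 1
    rw [hz', map_sub, map_sub]; abel
  have hzb : G z - Φ b z ∈ L := by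
    have h1 := L.sub_mem (L.sub_mem (hGL _ hzz) (hL b hb _ hzz)) hzb'
    convert h1 using 1
    rw [map_add, map_add]; abel
  have hzL : z ∈ L := by
    by_contra h
    refine hab (hinj a ha b hb z ?_ h)
    have := L.sub_mem hzb hza
    convert this using 1
    abel
  have hac : a = c := hinj a ha c hc v₀ hzL hv₀
  have hbc : b = c := hinj b hb c hc w ((L.add_mem_iff_right hzL).1 hzz) hw
  exact hab (hac.trans hbc.symm)

variable {V : Type*} [AddCommGroup V] [Module ℝ V] {A B C : Submodule ℝ V}

theorem exists_add_eq_of_isInternal (h : DirectSum.IsInternal ![A, B, C]) (v : V) :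
    ∃ a ∈ A, ∃ b ∈ B, ∃ c ∈ C, a + b + c = v := by
  have htop := h.submodule_iSup_eq_top
  have hle : (⨆ i, ![A, B, C] i) ≤ A ⊔ B ⊔ C := by
    refine iSup_le fun i ↦ ?_
    fin_cases i
    · exact le_sup_of_le_left le_sup_left
    · exact le_sup_of_le_left le_sup_right
    · exact le_sup_right
  have hv : v ∈ A ⊔ B ⊔ C := hle (htop ▸ Submodule.mem_top)
  obtain ⟨y, hy, c, hc, rfl⟩ := Submodule.mem_sup.1 hv
  obtain ⟨a, ha, b, hb, rfl⟩ := Submodule.mem_sup.1 hy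
  exact ⟨a, ha, b, hb, c, hc, rfl⟩

theorem eq_zero_of_isInternal (h : DirectSum.IsInternal ![A, B, C]) {a b c : V} (ha : a ∈ A)
    (hb : b ∈ B) (hc : c ∈ C) (habc : a + b + c = 0) : a = 0 ∧ c = 0 := by
  have hind := iSupIndep_def.1 h.submodule_iSupIndep
  have hmem : ∀ i j : Fin 3, j ≠ i → ∀ x ∈ ![A, B, C] j,
      x ∈ ⨆ j, ⨆ _ : j ≠ i, ![A, B, C] j := fun i j hij x hx ↦
    Submodule.mem_iSup_of_mem j (Submodule.mem_iSup_of_mem hij hx)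
  constructor
  · refine (Submodule.disjoint_def.1 (hind 0)) a ha ?_
    have : a = -(b + c) := by rw [← sub_eq_zero, ← habc]; abel
    rw [this]
    exact neg_mem (add_mem (hmem 0 1 (by decide) b hb) (hmem 0 2 (by decide) c hc))
  · refine (Submodule.disjoint_def.1 (hind 2)) c hc ?_
    have : c = -(a + b) := by rw [← sub_eq_zero, ← habc]; abel
    rw [this]
    exact neg_mem (add_mem (hmem 2 0 (by decide) a ha) (hmem 2 1 (by decide) b hb))

/-- A locally bounded periodic function that is halved by some translation vanishes. -/
theorem eq_zero_of_periodic_of_half {w : ℝ → ℝ} (hw0 : ∀ t, 0 ≤ w t) {h S : ℝ} (hh : h ≠ 0)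
    (hper : ∀ t, w (t + h) = w t) (hhalf : ∀ t, w (S + t) ≤ 1 / 2 * w t)
    (hbdd : ∀ t, ∃ C, ∀ᶠ s in 𝓝 t, w s ≤ C) : w 0 = 0 := by
  have hP : Function.Periodic w h := hper
  obtain ⟨C, hC⟩ : ∃ C, ∀ t ∈ Icc (0 : ℝ) |h|, w t ≤ C := by
    choose C hC using hbdd
    obtain ⟨F, -, hF⟩ := (isCompact_Icc (a := (0 : ℝ)) (b := |h|)).elim_nhds_subcover
      (fun t ↦ {s | w s ≤ C t}) fun t _ ↦ hC t
    refine ⟨∑ t ∈ F, |C t|, fun t ht ↦ ?_⟩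
    obtain ⟨i, hi, hti⟩ := mem_iUnion₂.1 (hF ht)
    exact (hti.trans (le_abs_self _)).trans
      (Finset.single_le_sum (f := fun t ↦ |C t|) (fun _ _ ↦ abs_nonneg _) hi)
  have hP' : Function.Periodic w |h| := by
    rcases abs_choice h with h' | h' <;> rw [h']
    · exact hP
    · exact hP.neg
  have hall : ∀ t, w t ≤ C := by
    intro t
    obtain ⟨y, hy, hty⟩ := hP'.exists_mem_Ico₀ (abs_pos.2 hh) t
    rw [hty]
    exact hC y (Ico_subset_Icc_self hy)
  have hit : ∀ n : ℕ, ∀ t, w t ≤ (1 / 2) ^ n * C := by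
    intro n
    induction n with
    | zero => simpa using hall
    | succ n ih =>
      intro t
      -- The sign of `S` plays no role, so the same argument serves the stable bundle with `S` and
      -- the unstable one with `-S`.
      have h1 := hhalf (t - S)
      rw [add_sub_cancel] at h1
      have h2 := ih (t - S)
      rw [pow_succ]
      linarith
  have hlim : Tendsto (fun n : ℕ ↦ (1 / 2 : ℝ) ^ n * C) atTop (𝓝 0) := by
    simpa using (tendsto_pow_atTop_nhds_zero_of_lt_one (by norm_num : (0 : ℝ) ≤ 1 / 2)
      (by norm_num)).mul_const C
  exact le_antisymm (ge_of_tendsto' hlim fun n ↦ hit n 0) (hw0 0)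

end Algebra

/-! ### Derivatives of self-maps in model coordinates. -/

section ModelDeriv

variable {d : ℕ} {M : Type*} [TopologicalSpace M] [ChartedSpace (EuclideanSpace ℝ (Fin d)) M]

/-- The derivative of a self-map of `M`, read in the model space. -/
def modelDeriv (g : M → M) (p : M) : EuclideanSpace ℝ (Fin d) →L[ℝ] EuclideanSpace ℝ (Fin d) :=
  mfderiv (𝓡 d) (𝓡 d) g p

theorem modelDeriv_comp {g g' : M → M} {p : M} (hg : MDifferentiableAt (𝓡 d) (𝓡 d) g (g' p))
    (hg' : MDifferentiableAt (𝓡 d) (𝓡 d) g' p) (v : EuclideanSpace ℝ (Fin d)) :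
    modelDeriv (d := d) (g ∘ g') p v = modelDeriv g (g' p) (modelDeriv g' p v) := by
  unfold modelDeriv
  rw [mfderiv_comp p hg hg']
  rfl

theorem modelDeriv_id (p : M) (v : EuclideanSpace ℝ (Fin d)) :
    modelDeriv (d := d) (id : M → M) p v = v := by
  unfold modelDeriv
  rw [mfderiv_id]
  rfl

/-- At a fixed point the source and target charts coincide, so the manifold derivative is an
ordinary derivative in one chart. -/
theorem hasFDerivAt_of_fixed {g : M → M} {p : M} (hg : MDifferentiableAt (𝓡 d) (𝓡 d) g p)
    (hp : g p = p) :
    HasFDerivAt (fun x ↦ extChartAt (𝓡 d) p (g ((extChartAt (𝓡 d) p).symm x)))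
      (modelDeriv g p) (extChartAt (𝓡 d) p p) := by
  have h := hg.hasMFDerivAt.2
  have h' : HasFDerivWithinAt (writtenInExtChartAt (𝓡 d) (𝓡 d) p g) (modelDeriv g p)
    (range (𝓡 d)) (extChartAt (𝓡 d) p p) := h
  unfold writtenInExtChartAt at h'
  rw [hp] at h'
  exact h'.hasFDerivAt (by simp)

end ModelDeriv

/-! ### The derivative of the flow along hyperbolic orbits. -/

section FlowDerivative

variable {d : ℕ} {M : Type*} [TopologicalSpace M] [T2Space M] [CompactSpace M]
  [ChartedSpace (EuclideanSpace ℝ (Fin d)) M] [IsManifold (𝓡 d) ∞ M]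
  {X : ∀ x : M, TangentSpace (𝓡 d) x}

/-- A map that commutes with the flow preserves the vector field. -/
theorem modelDeriv_modelField (hX : IsC1VectorField X) {g : M → M} {p : M}
    (hg : MDifferentiableAt (𝓡 d) (𝓡 d) g p) (hcomm : ∀ t, g (flow X t p) = flow X t (g p)) :
    modelDeriv g p (modelField X p) = modelField X (g p) := by
  have h1 := isMIntegralCurve_flow hX p 0
  have h2 := isMIntegralCurve_flow hX (g p) 0
  have hg' : HasMFDerivAt (𝓡 d) (𝓡 d) g (flow X 0 p) (mfderiv (𝓡 d) (𝓡 d) g (flow X 0 p)) := by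
    rw [flow_zero hX]; exact hg.hasMFDerivAt
  have h3 := HasMFDerivAt.comp (0 : ℝ) hg' h1
  have h4 : g ∘ (fun t ↦ flow X t p) = fun t ↦ flow X t (g p) := funext hcomm
  rw [h4] at h3
  have h5 := hasMFDerivAt_unique h3 h2
  have h6 : modelDeriv g (flow X 0 p) (((1 : ℝ →L[ℝ] ℝ).smulRight (modelField X (flow X 0 p))) 1) =
      ((1 : ℝ →L[ℝ] ℝ).smulRight (modelField X (flow X 0 (g p)))) 1 :=
    congrArg (fun A : ℝ →L[ℝ] EuclideanSpace ℝ (Fin d) ↦ A 1) h5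
  rw [flow_zero hX, flow_zero hX] at h6
  simpa only [ContinuousLinearMap.smulRight_apply, one_apply_eq_self, one_smul] using h6

theorem modelDeriv_flow_add (hX : IsC1VectorField X) {s t : ℝ} {p : M}
    (hs : MDifferentiableAt (𝓡 d) (𝓡 d) (flow X s) (flow X t p))
    (ht : MDifferentiableAt (𝓡 d) (𝓡 d) (flow X t) p) (v : EuclideanSpace ℝ (Fin d)) :
    modelDeriv (flow X (s + t)) p v =
      modelDeriv (flow X s) (flow X t p) (modelDeriv (flow X t) p v) := by
  rw [← modelDeriv_comp hs ht]
  congr 2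
  funext x
  exact flow_add hX s t x

theorem modelDeriv_flow_zero (hX : IsC1VectorField X) (p : M) (v : EuclideanSpace ℝ (Fin d)) :
    modelDeriv (flow X 0) p v = v := by
  have : flow X 0 = (id : M → M) := funext fun x ↦ flow_zero hX x
  rw [this, modelDeriv_id]

theorem mem_orbit_self (hX : IsC1VectorField X) (p : M) : p ∈ orbit X p :=
  ⟨0, mem_univ _, flow_zero hX p⟩

variable [RiemannianBundle (fun x : M ↦ TangentSpace (𝓡 d) x)]

/-- The Riemannian norm of a tangent vector at `x` given in the model space. -/
def fiberNorm (x : M) (v : EuclideanSpace ℝ (Fin d)) : ℝ :=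
  norm (E := TangentSpace (𝓡 d) x) v

/-- The derivatives of the flow are bounded for small times. -/
theorem exists_fiberNorm_le
    [IsContMDiffRiemannianBundle (𝓡 d) ∞ (EuclideanSpace ℝ (Fin d))
      (fun x : M ↦ TangentSpace (𝓡 d) x)]
    (hX : IsC1VectorField X) (y : M)
    (hd : ∀ s, MDifferentiableAt (𝓡 d) (𝓡 d) (flow X s) y) (u : EuclideanSpace ℝ (Fin d)) :
    ∃ C, ∀ᶠ s in 𝓝 (0 : ℝ), fiberNorm (flow X s y) (modelDeriv (flow X s) y u) ≤ C := by
  have hcR : IsContinuousRiemannianBundle (EuclideanSpace ℝ (Fin d))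
      (fun x : M ↦ TangentSpace (𝓡 d) x) := by
    obtain ⟨g, hg, h⟩ := IsContMDiffRiemannianBundle.exists_contMDiff (IB := 𝓡 d) (n := ∞)
      (F := EuclideanSpace ℝ (Fin d)) (E := fun x : M ↦ TangentSpace (𝓡 d) x)
    exact ⟨g, hg.continuous, h⟩
  obtain ⟨C, hC, hCy⟩ := eventually_norm_symmL_trivializationAt_lt (EuclideanSpace ℝ (Fin d))
    (fun x : M ↦ TangentSpace (𝓡 d) x) y
  obtain ⟨ε, hε, U, hU, L, hL, hsrc, hlip⟩ := exists_flow_lipschitz hX y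
  have hyU := mem_of_mem_nhds hU
  have hct : Tendsto (fun s ↦ flow X s y) (𝓝 0) (𝓝 y) := by
    have := (continuous_flow_time hX y).tendsto 0
    rwa [flow_zero hX] at this
  refine ⟨C * (L * ‖u‖), ?_⟩
  filter_upwards [hct.eventually hCy, Ioo_mem_nhds (by linarith : -ε < 0) hε] with s hs hsε
  set φ := extChartAt (𝓡 d) y with hφ
  set z := flow X s y with hz
  have hzsrc : z ∈ (chartAt (EuclideanSpace ℝ (Fin d)) y).source := by
    rw [← extChartAt_source (𝓡 d)]; exact hsrc y hyU s hsε
  have h1 := HasMFDerivAt.comp y (mdifferentiableAt_extChartAt (I := 𝓡 d) hzsrc).hasMFDerivAt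
    (hd s).hasMFDerivAt
  have hder : HasFDerivAt (fun x ↦ φ (flow X s (φ.symm x)))
      ((mfderiv (𝓡 d) 𝓘(ℝ, EuclideanSpace ℝ (Fin d)) φ z :
        EuclideanSpace ℝ (Fin d) →L[ℝ] EuclideanSpace ℝ (Fin d)).comp
        (modelDeriv (flow X s) y)) (φ y) := by
    have := h1.2
    exact HasFDerivWithinAt.hasFDerivAt (s := range (𝓡 d)) this (by simp)
  -- The Lipschitz constant of the flow in the chart bounds its derivative, so no continuity of
  -- `DX_s` in `s` is needed.
  have hbound := hder.le_of_lip' hL (by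
    have hev : ∀ᶠ x in 𝓝 (φ y), x ∈ φ.target ∧ φ.symm x ∈ U := by
      refine (show ∀ᶠ x in 𝓝 (φ y), x ∈ φ.target from extChartAt_target_mem_nhds y).and ?_
      refine (continuousAt_extChartAt_symm (I := 𝓡 d) y).eventually_mem ?_
      rwa [extChartAt_to_inv]
    filter_upwards [hev] with x hx
    have := hlip _ hx.2 _ hyU s hsε
    rw [φ.right_inv hx.1] at this
    simpa only [hφ, extChartAt_to_inv] using this)
  set e := trivializationAt (EuclideanSpace ℝ (Fin d)) (fun x : M ↦ TangentSpace (𝓡 d) x) y with he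
  have hbase : z ∈ e.baseSet := hzsrc
  have hclm := TangentBundle.continuousLinearMapAt_trivializationAt (I := 𝓡 d) hzsrc
  let w : TangentSpace (𝓡 d) z := modelDeriv (flow X s) y u
  let a : EuclideanSpace ℝ (Fin d) := e.continuousLinearMapAt ℝ z w
  have ha : ‖a‖ ≤ L * ‖u‖ := by
    have h2 := ContinuousLinearMap.le_of_opNorm_le _ hbound u
    have h3 : a = ((mfderiv (𝓡 d) 𝓘(ℝ, EuclideanSpace ℝ (Fin d)) φ z :
        EuclideanSpace ℝ (Fin d) →L[ℝ] EuclideanSpace ℝ (Fin d)).comp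
        (modelDeriv (flow X s) y)) u :=
      congrArg (fun A : TangentSpace (𝓡 d) z →L[ℝ] EuclideanSpace ℝ (Fin d) ↦ A w) hclm
    rw [h3]
    exact h2
  have hw : e.symmL ℝ z a = w := e.symmL_continuousLinearMapAt hbase w
  calc fiberNorm z (modelDeriv (flow X s) y u) = ‖w‖ := rfl
    _ = ‖e.symmL ℝ z a‖ := by rw [hw]
    _ ≤ ‖e.symmL ℝ z‖ * ‖a‖ := (e.symmL ℝ z).le_opNorm a
    _ ≤ C * (L * ‖u‖) := by
      gcongr

/-- A vector whose forward (or backward) iterates are contracted and which is fixed by the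
derivative of the flow at a return time vanishes. -/
theorem eq_zero_of_contracted
    [IsContMDiffRiemannianBundle (𝓡 d) ∞ (EuclideanSpace ℝ (Fin d))
      (fun x : M ↦ TangentSpace (𝓡 d) x)]
    (hX : IsC1VectorField X) {p : M}
    (hd : ∀ s t, MDifferentiableAt (𝓡 d) (𝓡 d) (flow X s) (flow X t p))
    {h S : ℝ} (hh : h ≠ 0) (hp : flow X h p = p) {v : EuclideanSpace ℝ (Fin d)}
    (hv : modelDeriv (flow X h) p v = v)
    (hS : ∀ t, fiberNorm (flow X S (flow X t p))
      (modelDeriv (flow X S) (flow X t p) (modelDeriv (flow X t) p v)) ≤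
        1 / 2 * fiberNorm (flow X t p) (modelDeriv (flow X t) p v)) : v = 0 := by
  have hd0 : ∀ s, MDifferentiableAt (𝓡 d) (𝓡 d) (flow X s) p := fun s ↦ by
    simpa [flow_zero hX] using hd s 0
  have key := eq_zero_of_periodic_of_half
    (w := fun t ↦ fiberNorm (flow X t p) (modelDeriv (flow X t) p v))
    (fun t ↦ norm_nonneg (E := TangentSpace (𝓡 d) (flow X t p)) _) (h := h) (S := S) hh ?_ ?_ ?_
  · simp only [flow_zero hX, modelDeriv_flow_zero hX] at key
    exact (norm_eq_zero (E := TangentSpace (𝓡 d) p)).1 key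
  · intro t
    simp only [modelDeriv_flow_add hX (hd t h) (hd0 h), flow_add hX, hp, hv]
  · intro t
    simp only [modelDeriv_flow_add hX (hd S t) (hd0 t), flow_add hX]
    exact hS t
  · intro t
    obtain ⟨C, hC⟩ := exists_fiberNorm_le hX (flow X t p) (fun s ↦ hd s t)
      (modelDeriv (flow X t) p v)
    refine ⟨C, ?_⟩
    have hsub : Tendsto (fun s ↦ s - t) (𝓝 t) (𝓝 0) := by
      exact (by fun_prop : Continuous fun s : ℝ ↦ s - t).tendsto' t 0 (sub_self t)
    filter_upwards [hsub.eventually hC] with s hs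
    rw [← modelDeriv_flow_add hX (hd _ t) (hd0 t), ← flow_add hX, sub_add_cancel] at hs
    exact hs

/-- On a hyperbolic orbit of positive codimension the flow is differentiable. This holds for every
`C^1` field; here it is read off from the nonzero invariant bundles. -/
theorem mdifferentiableAt_flow_of_isHyperbolicSet (hX : IsC1VectorField X) {p : M}
    (hhyp : IsHyperbolicSet X (orbit X p)) (hne : Submodule.span ℝ {X p} ≠ ⊤) (s t : ℝ) :
    MDifferentiableAt (𝓡 d) (𝓡 d) (flow X s) (flow X t p) := by
  obtain ⟨-, -, Es, Eu, -, -, hint, hinv, -⟩ := hhyp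
  have hpo : ∀ t, flow X t p ∈ orbit X p := fun t ↦ ⟨t, mem_univ _, rfl⟩
  by_contra hnd
  -- The default value of `mfderiv` at a point of nondifferentiability is `0`. Invariance then kills
  -- both bundles at the image point and, flowing back, at `p`, leaving only the flow direction.
  have hz : flowDeriv X s (flow X t p) = 0 := mfderiv_zero_of_not_mdifferentiableAt hnd
  have hbot := hinv _ (hpo t) s
  rw [hz] at hbot
  have hs : Es (flow X s (flow X t p)) = ⊥ := by
    rw [← hbot.1]; exact Submodule.map_zero _
  have hu : Eu (flow X s (flow X t p)) = ⊥ := by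
    rw [← hbot.2]; exact Submodule.map_zero _
  rw [← flow_add hX] at hs hu
  have hback := hinv _ (hpo (s + t)) (-(s + t))
  rw [hs, hu, Submodule.map_bot, flow_neg_flow hX] at hback
  apply hne
  rw [eq_top_iff]
  intro v _
  obtain ⟨a, ha, b, hb, c, hc, rfl⟩ :=
    exists_add_eq_of_isInternal (hint p (mem_orbit_self hX p)) v
  rw [← hback.1, Submodule.mem_bot] at ha
  rw [← hback.2, Submodule.mem_bot] at hc
  rw [ha, hc, zero_add, add_zero]
  exact hb

/-- At a hyperbolic critical point, the derivative of the flow at a nonzero return time has no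
fixed vectors transverse to the flow direction. -/
theorem mem_span_of_isHyperbolicSet
    [IsContMDiffRiemannianBundle (𝓡 d) ∞ (EuclideanSpace ℝ (Fin d))
      (fun x : M ↦ TangentSpace (𝓡 d) x)]
    (hX : IsC1VectorField X) {p : M}
    (hhyp : IsHyperbolicSet X (orbit X p)) (hne : Submodule.span ℝ {X p} ≠ ⊤)
    {h : ℝ} (hh : h ≠ 0) (hp : flow X h p = p) {v : EuclideanSpace ℝ (Fin d)}
    (hv : modelDeriv (flow X h) p v - v ∈ Submodule.span ℝ {modelField X p}) :
    v ∈ Submodule.span ℝ {modelField X p} := by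
  have hd := mdifferentiableAt_flow_of_isHyperbolicSet hX hhyp hne
  have hd0 : ∀ s, MDifferentiableAt (𝓡 d) (𝓡 d) (flow X s) p := fun s ↦ by
    simpa [flow_zero hX] using hd s 0
  obtain ⟨-, -, Es, Eu, -, -, hint, hinv, S, hS, hcontr⟩ := hhyp
  have hpo : ∀ t, flow X t p ∈ orbit X p := fun t ↦ ⟨t, mem_univ _, rfl⟩
  have hpp : p ∈ orbit X p := mem_orbit_self hX p
  let Fs : M → Submodule ℝ (EuclideanSpace ℝ (Fin d)) := fun x ↦ Es x
  let Fu : M → Submodule ℝ (EuclideanSpace ℝ (Fin d)) := fun x ↦ Eu x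
  have hFs : ∀ t, ∀ u ∈ Fs p, modelDeriv (flow X t) p u ∈ Fs (flow X t p) := by
    intro t u hu
    have := (hinv p hpp t).1
    exact this.le (Submodule.mem_map_of_mem hu)
  have hFu : ∀ t, ∀ u ∈ Fu p, modelDeriv (flow X t) p u ∈ Fu (flow X t p) := by
    intro t u hu
    have := (hinv p hpp t).2
    exact this.le (Submodule.mem_map_of_mem hu)
  have hcs : ∀ t, ∀ u ∈ Fs (flow X t p), fiberNorm (flow X S (flow X t p))
      (modelDeriv (flow X S) (flow X t p) u) ≤ 1 / 2 * fiberNorm (flow X t p) u := by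
    intro t u hu
    exact ContinuousLinearMap.le_of_opNorm_le _ (hcontr _ (hpo t)).1.le
      (⟨u, hu⟩ : Es (flow X t p))
  have hcu : ∀ t, ∀ u ∈ Fu (flow X t p), fiberNorm (flow X (-S) (flow X t p))
      (modelDeriv (flow X (-S)) (flow X t p) u) ≤ 1 / 2 * fiberNorm (flow X t p) u := by
    intro t u hu
    exact ContinuousLinearMap.le_of_opNorm_le _ (hcontr _ (hpo t)).2.le
      (⟨u, hu⟩ : Eu (flow X t p))
  have hi : DirectSum.IsInternal ![Fs p, Submodule.span ℝ {modelField X p}, Fu p] := hint p hpp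
  obtain ⟨a, ha, b, hb, c, hc, rfl⟩ := exists_add_eq_of_isInternal hi v
  have hbL : modelDeriv (flow X h) p b ∈ Submodule.span ℝ {modelField X p} := by
    obtain ⟨r, rfl⟩ := Submodule.mem_span_singleton.1 hb
    rw [map_smul, modelDeriv_modelField hX (hd0 h) (fun t ↦ flow_comm hX h t p), hp]
    exact Submodule.smul_mem _ _ (Submodule.mem_span_singleton_self _)
  have ha' := hFs h a ha
  have hc' := hFu h c hc
  rw [hp] at ha' hc'
  -- The components of `DX_h v - v` in the stable and unstable spaces vanish because the whole
  -- vector lies in the flow direction; it is absorbed into the middle summand.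
  obtain ⟨hea, hec⟩ := eq_zero_of_isInternal hi (sub_mem ha' ha)
    (sub_mem (sub_mem hbL hb) hv) (sub_mem hc' hc) (by
      simp only [map_add]
      abel)
  have ha0 : a = 0 := eq_zero_of_contracted hX hd hh hp (sub_eq_zero.1 hea)
    fun t ↦ hcs t _ (hFs t a ha)
  have hc0 : c = 0 := eq_zero_of_contracted hX hd hh hp (sub_eq_zero.1 hec)
    fun t ↦ hcu t _ (hFu t c hc)
  rwa [ha0, hc0, zero_add, add_zero]

end FlowDerivative

/-! ### First-order expansion of the flow, limit directions and transversals. -/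

section Transverse

variable {d : ℕ} {M : Type*} [TopologicalSpace M] [T2Space M] [CompactSpace M]
  [ChartedSpace (EuclideanSpace ℝ (Fin d)) M] [IsManifold (𝓡 d) ∞ M]
  {X : ∀ x : M, TangentSpace (𝓡 d) x}

/-- Mean value inequality for `s ↦ φ(X_s y) - s • w`. The symmetric interval covers both signs of
`ε`. -/
theorem norm_chart_flow_sub_le (hX : IsC1VectorField X) {p y : M} {ε η : ℝ}
    {w : EuclideanSpace ℝ (Fin d)}
    (h : ∀ s, |s| ≤ |ε| → flow X s y ∈ (extChartAt (𝓡 d) p).source ∧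
      ‖chartField X p (extChartAt (𝓡 d) p (flow X s y)) - w‖ ≤ η) :
    ‖extChartAt (𝓡 d) p (flow X ε y) - extChartAt (𝓡 d) p y - ε • w‖ ≤ η * |ε| := by
  have hder : ∀ s ∈ Icc (-|ε|) |ε|, HasDerivWithinAt
      (fun s ↦ extChartAt (𝓡 d) p (flow X s y) - s • w)
      (chartField X p (extChartAt (𝓡 d) p (flow X s y)) - w) (Icc (-|ε|) |ε|) s := by
    intro s hs
    have h1 := hasDerivAt_chart_comp (isMIntegralCurve_flow hX y s) (h s (abs_le.2 hs)).1
    have h2 : HasDerivAt (fun s : ℝ ↦ s • w) w s := by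
      simpa using (hasDerivAt_id s).smul_const w
    exact (h1.sub h2).hasDerivWithinAt
  have hmv := Convex.norm_image_sub_le_of_norm_hasDerivWithin_le hder
    (fun s hs ↦ (h s (abs_le.2 hs)).2) (convex_Icc _ _)
    (⟨by simp, abs_nonneg ε⟩ : (0 : ℝ) ∈ Icc (-|ε|) |ε|)
    (⟨neg_abs_le ε, le_abs_self ε⟩ : ε ∈ Icc (-|ε|) |ε|)
  simp only [flow_zero hX, zero_smul, sub_zero, Real.norm_eq_abs] at hmv
  rw [sub_right_comm]
  exact hmv

/-- To first order the flow at small times is the translation by the vector field. -/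
theorem eventually_norm_chart_flow_sub_le (hX : IsC1VectorField X) (p : M) {η : ℝ} (hη : 0 < η) :
    ∀ᶠ z : ℝ × M in 𝓝 (0, p), ‖extChartAt (𝓡 d) p (flow X z.1 z.2) -
      extChartAt (𝓡 d) p z.2 - z.1 • modelField X p‖ ≤ η * |z.1| := by
  have hflow : Tendsto (fun z : ℝ × M ↦ flow X z.1 z.2) (𝓝 (0, p)) (𝓝 p) := by
    have := (continuous_flow hX).tendsto (0, p)
    rwa [flow_zero hX] at this
  have hV : Tendsto (fun z : ℝ × M ↦ chartField X p (extChartAt (𝓡 d) p (flow X z.1 z.2)))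
      (𝓝 (0, p)) (𝓝 (modelField X p)) := by
    rw [← chartField_self p]
    exact ((contDiffAt_chartField hX p).continuousAt.tendsto.comp
      (continuousAt_extChartAt (I := 𝓡 d) p).tendsto).comp hflow
  have hgood : ∀ᶠ z : ℝ × M in 𝓝 (0, p), flow X z.1 z.2 ∈ (extChartAt (𝓡 d) p).source ∧
      ‖chartField X p (extChartAt (𝓡 d) p (flow X z.1 z.2)) - modelField X p‖ ≤ η := by
    refine (hflow.eventually_mem (extChartAt_source_mem_nhds p)).and ?_
    have := hV.eventually (closedBall_mem_nhds _ hη)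
    filter_upwards [this] with z hz
    rwa [dist_eq_norm] at hz
  -- A product neighbourhood with a ball of times is needed: the estimate must hold at all
  -- intermediate times `s`, `|s| ≤ |t|`.
  rw [nhds_prod_eq] at hgood ⊢
  obtain ⟨P, hP, Q, hQ, hPQ⟩ := eventually_prod_iff.1 hgood
  obtain ⟨δ, hδ, hδP⟩ := Metric.eventually_nhds_iff_ball.1 hP
  have hb : ∀ᶠ t : ℝ in 𝓝 0, t ∈ ball (0 : ℝ) δ := ball_mem_nhds _ hδ
  refine eventually_prod_iff.2 ⟨_, hb, Q, hQ, fun {t} ht {q} hq ↦ ?_⟩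
  refine norm_chart_flow_sub_le hX fun s hs ↦ hPQ (hδP s ?_) hq
  rw [mem_ball_zero_iff, Real.norm_eq_abs] at ht ⊢
  exact hs.trans_lt ht

/-- Near a singularity the displacement at small times is controlled by the distance to the
singularity. -/
theorem eventually_norm_chart_flow_sub_le_of_singular (hX : IsC1VectorField X) {p : M}
    (hp : X p = 0) : ∃ C : ℝ, ∀ᶠ z : ℝ × M in 𝓝 (0, p),
      ‖extChartAt (𝓡 d) p (flow X z.1 z.2) - extChartAt (𝓡 d) p z.2‖ ≤
        C * ‖extChartAt (𝓡 d) p z.2 - extChartAt (𝓡 d) p p‖ * |z.1| := by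
  obtain ⟨ε, hε, U, hU, L, hL, hsrc, hlip⟩ := exists_flow_lipschitz hX p
  obtain ⟨K, W, hW, hK⟩ := (contDiffAt_chartField hX p).exists_lipschitzOnWith
  have hpU := mem_of_mem_nhds hU
  have hflow : Tendsto (fun z : ℝ × M ↦ extChartAt (𝓡 d) p (flow X z.1 z.2)) (𝓝 (0, p))
      (𝓝 (extChartAt (𝓡 d) p p)) := by
    have := (continuous_flow hX).tendsto (0, p)
    rw [flow_zero hX] at this
    exact (continuousAt_extChartAt (I := 𝓡 d) p).tendsto.comp this
  have hgood : ∀ᶠ z : ℝ × M in 𝓝 (0, p),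
      extChartAt (𝓡 d) p (flow X z.1 z.2) ∈ W ∧ z.1 ∈ Ioo (-ε) ε ∧ z.2 ∈ U :=
    (hflow.eventually_mem hW).and (prod_mem_nhds (Ioo_mem_nhds (by linarith) hε) hU)
  refine ⟨K * L, ?_⟩
  rw [nhds_prod_eq] at hgood ⊢
  obtain ⟨P, hP, Q, hQ, hPQ⟩ := eventually_prod_iff.1 hgood
  obtain ⟨δ, hδ, hδP⟩ := Metric.eventually_nhds_iff_ball.1 hP
  have hb : ∀ᶠ t : ℝ in 𝓝 0, t ∈ ball (0 : ℝ) δ := ball_mem_nhds _ hδ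
  refine eventually_prod_iff.2 ⟨_, hb, Q, hQ, fun {t} ht {q} hq ↦ ?_⟩
  -- With `w = 0`: the field vanishes at `p` and is `K`-Lipschitz, and the flow spreads distances to
  -- `p` by at most `L`.
  have key := norm_chart_flow_sub_le (X := X) hX (p := p) (y := q) (ε := t) (w := 0)
    (η := K * L * ‖extChartAt (𝓡 d) p q - extChartAt (𝓡 d) p p‖) fun s hs ↦ ?_
  · simpa using key
  · have hsb : s ∈ ball (0 : ℝ) δ := by
      rw [mem_ball_zero_iff, Real.norm_eq_abs] at ht ⊢
      exact hs.trans_lt ht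
    obtain ⟨h1, h2, h3⟩ := hPQ (hδP s hsb) hq
    refine ⟨hsrc q h3 s h2, ?_⟩
    have h4 := hlip q h3 p hpU s h2
    rw [flow_of_singular hX hp] at h4
    have h5 := hK.dist_le_mul _ h1 _ (mem_of_mem_nhds hW)
    have h0 : modelField X p = 0 := hp
    rw [chartField_self, h0, dist_eq_norm, dist_eq_norm] at h5
    refine h5.trans ?_
    rw [mul_assoc]
    gcongr

/-- If `g` fixes `p` and moves the points `q n` near `p` along their orbits by times tending to a
return time `h` of `p`, then along limit directions of `q n - p` the derivatives of `g` and of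
the time `h` map agree modulo the flow direction. -/
theorem modelDeriv_sub_mem_span (hX : IsC1VectorField X) {p : M} {g : M → M}
    (hg : MDifferentiableAt (𝓡 d) (𝓡 d) g p) (hgp : g p = p) {h : ℝ} (hhp : flow X h p = p)
    (hd : MDifferentiableAt (𝓡 d) (𝓡 d) (flow X h) p)
    {q : ℕ → M} (hq : Tendsto q atTop (𝓝 p)) {t : ℕ → ℝ} (ht : Tendsto t atTop (𝓝 h))
    (hgq : ∀ n, g (q n) = flow X (t n) (q n)) {c : ℕ → ℝ} {v : EuclideanSpace ℝ (Fin d)}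
    (hv : Tendsto (fun n ↦ c n • (extChartAt (𝓡 d) p (q n) - extChartAt (𝓡 d) p p)) atTop (𝓝 v)) :
    modelDeriv g p v - modelDeriv (flow X h) p v ∈ Submodule.span ℝ {modelField X p} := by
  set φ := extChartAt (𝓡 d) p with hφ
  have hφq : Tendsto (fun n ↦ φ (q n) - φ p) atTop (𝓝 0) := by
    rw [← sub_self (φ p)]
    exact ((continuousAt_extChartAt (I := 𝓡 d) p).tendsto.comp hq).sub_const (φ p)
  have hsrc : ∀ᶠ n in atTop, q n ∈ φ.source := hq.eventually_mem (extChartAt_source_mem_nhds p)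
  have hlim : ∀ {k : M → M}, MDifferentiableAt (𝓡 d) (𝓡 d) k p → k p = p →
      Tendsto (fun n ↦ c n • (φ (k (q n)) - φ p)) atTop (𝓝 (modelDeriv k p v)) := by
    intro k hk hkp
    have h1 := (hasFDerivAt_of_fixed hk hkp).hasFDerivWithinAt (s := univ)
    have h2 := h1.lim hφq (Eventually.of_forall fun _ ↦ mem_univ _) hv
    refine h2.congr' ?_
    filter_upwards [hsrc] with n hn
    rw [← hφ, add_sub_cancel, φ.left_inv hn, hφ, extChartAt_to_inv, hkp]
  have hG := hlim hg hgp
  have hΦ := hlim hd hhp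
  have hy : Tendsto (fun n ↦ flow X h (q n)) atTop (𝓝 p) := by
    have := ((continuous_flow_space hX h).tendsto p).comp hq
    rwa [hhp] at this
  have hε : Tendsto (fun n ↦ t n - h) atTop (𝓝 0) := by simpa using ht.sub_const h
  have hz : Tendsto (fun n ↦ (t n - h, flow X h (q n))) atTop (𝓝 ((0 : ℝ), p)) :=
    hε.prodMk_nhds hy
  have hgq' : ∀ n, flow X (t n - h) (flow X h (q n)) = g (q n) := fun n ↦ by
    rw [hgq, ← flow_add hX, sub_add_cancel]
  have he : Tendsto (fun n ↦ c n • (φ (g (q n)) - φ (flow X h (q n)))) atTop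
      (𝓝 (modelDeriv g p v - modelDeriv (flow X h) p v)) := by
    refine (hG.sub hΦ).congr fun n ↦ ?_
    rw [← smul_sub, sub_sub_sub_cancel_right]
  by_cases hp : X p = 0
  -- At a singularity the rescaled displacement is a bounded quantity times `|t n - h|`, so the two
  -- derivatives agree exactly on `v`.
  · obtain ⟨C, hC⟩ := eventually_norm_chart_flow_sub_le_of_singular hX hp
    have h0 : Tendsto (fun n ↦ c n • (φ (g (q n)) - φ (flow X h (q n)))) atTop (𝓝 0) := by
      have hb : Tendsto (fun n ↦ C * ‖c n • (φ (flow X h (q n)) - φ p)‖ * |t n - h|) atTop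
          (𝓝 (C * ‖modelDeriv (flow X h) p v‖ * |(0 : ℝ)|)) :=
        (hΦ.norm.const_mul C).mul hε.abs
      rw [abs_zero, mul_zero] at hb
      refine squeeze_zero_norm' ?_ hb
      filter_upwards [hz.eventually hC] with n hn
      rw [hgq'] at hn
      rw [norm_smul, norm_smul]
      calc ‖c n‖ * ‖φ (g (q n)) - φ (flow X h (q n))‖
          ≤ ‖c n‖ * (C * ‖φ (flow X h (q n)) - φ p‖ * |t n - h|) := by gcongr
        _ = _ := by ring
    rw [tendsto_nhds_unique he h0]
    exact Submodule.zero_mem _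
  · have hx : modelField X p ≠ 0 := hp
    have hxn : 0 < ‖modelField X p‖ := norm_pos_iff.2 hx
    set z := modelDeriv g p v - modelDeriv (flow X h) p v with hzdef
    have hclose : ∀ η > 0, ∀ᶠ n in atTop, ‖c n • (φ (g (q n)) - φ (flow X h (q n))) -
        (c n * (t n - h)) • modelField X p‖ ≤ η * |c n * (t n - h)| := by
      intro η hη
      filter_upwards [hz.eventually (eventually_norm_chart_flow_sub_le hX p hη)] with n hn
      rw [hgq'] at hn
      rw [mul_smul, ← smul_sub, norm_smul, abs_mul, Real.norm_eq_abs]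
      calc |c n| * _ ≤ |c n| * (η * |t n - h|) := by gcongr
        _ = _ := by ring
    -- With `η = ‖X(p)‖ / 2` the error is absorbed into the left side. The coefficients are then
    -- bounded, so the error tends to zero and the limit is a limit of multiples of `X(p)`.
    have hbd : ∀ᶠ n in atTop, |c n * (t n - h)| ≤ 2 * (‖z‖ + 1) / ‖modelField X p‖ := by
      have h1 : ∀ᶠ n in atTop, ‖c n • (φ (g (q n)) - φ (flow X h (q n)))‖ < ‖z‖ + 1 :=
        he.norm.eventually (gt_mem_nhds (lt_add_one _))
      filter_upwards [h1, hclose _ (half_pos hxn)] with n h1 h2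
      have h3 : |c n * (t n - h)| * ‖modelField X p‖ ≤
          ‖c n • (φ (g (q n)) - φ (flow X h (q n)))‖ +
            ‖modelField X p‖ / 2 * |c n * (t n - h)| := by
        rw [← Real.norm_eq_abs, ← norm_smul]
        have := norm_sub_norm_le ((c n * (t n - h)) • modelField X p)
          (c n • (φ (g (q n)) - φ (flow X h (q n))))
        rw [norm_sub_rev] at this
        rw [← Real.norm_eq_abs] at h2
        linarith
      rw [le_div_iff₀ hxn]
      linarith
    set B := 2 * (‖z‖ + 1) / ‖modelField X p‖ with hB
    have hBpos : 0 < B := by positivity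
    have hdiff : Tendsto (fun n ↦ c n • (φ (g (q n)) - φ (flow X h (q n))) -
        (c n * (t n - h)) • modelField X p) atTop (𝓝 0) := by
      rw [tendsto_zero_iff_norm_tendsto_zero, Metric.tendsto_nhds]
      intro η hη
      filter_upwards [hclose (η / (2 * B)) (by positivity), hbd] with n h1 h2
      rw [dist_zero_right, norm_norm]
      refine h1.trans_lt ?_
      calc η / (2 * B) * |c n * (t n - h)| ≤ η / (2 * B) * B := by gcongr
        _ = η / 2 := by field_simp
        _ < η := half_lt_self hη
    have hfin := he.sub hdiff
    simp only [sub_sub_cancel, sub_zero] at hfin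
    exact (Submodule.closed_of_finiteDimensional (Submodule.span ℝ {modelField X p})).mem_of_tendsto
      hfin (Eventually.of_forall fun n ↦
        Submodule.smul_mem _ _ (Submodule.mem_span_singleton_self _))

/-- Points near `p` can be moved by small times into a hyperplane transverse to the flow. -/
theorem exists_transversal (hX : IsC1VectorField X) (p : M) :
    ∃ ℓ : EuclideanSpace ℝ (Fin d) →L[ℝ] ℝ,
      (∀ v ∈ Submodule.span ℝ {modelField X p}, ℓ v = 0 → v = 0) ∧
      ∀ W ∈ 𝓝 p, ∀ᶠ q in 𝓝 p, ∃ s, flow X s q ∈ W ∧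
        ℓ (extChartAt (𝓡 d) p (flow X s q) - extChartAt (𝓡 d) p p) = 0 := by
  by_cases hp : modelField X p = 0
  · refine ⟨0, fun v hv _ ↦ ?_, fun W hW ↦ ?_⟩
    · rwa [hp, Submodule.span_zero_singleton, Submodule.mem_bot] at hv
    · filter_upwards [hW] with q hq
      exact ⟨0, by rwa [flow_zero hX], rfl⟩
  obtain ⟨ℓ, hℓ⟩ : ∃ ℓ : EuclideanSpace ℝ (Fin d) →L[ℝ] ℝ, ℓ (modelField X p) = 1 :=
    SeparatingDual.exists_eq_one hp
  refine ⟨ℓ, fun v hv h0 ↦ ?_, fun W hW ↦ ?_⟩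
  · obtain ⟨r, rfl⟩ := Submodule.mem_span_singleton.1 hv
    rw [map_smul, hℓ, smul_eq_mul, mul_one] at h0
    rw [h0, zero_smul]
  set φ := extChartAt (𝓡 d) p with hφ
  have hflow : Tendsto (fun z : ℝ × M ↦ flow X z.1 z.2) (𝓝 (0, p)) (𝓝 p) := by
    have := (continuous_flow hX).tendsto (0, p)
    rwa [flow_zero hX] at this
  -- This makes the error at most `|s| / 2` after applying `ℓ`; the `+ 1` avoids any lower bound on
  -- `‖ℓ‖`.
  have hη : 0 < 1 / (2 * (‖ℓ‖ + 1)) := by positivity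
  have hgood : ∀ᶠ z : ℝ × M in 𝓝 (0, p), (flow X z.1 z.2 ∈ W ∧ flow X z.1 z.2 ∈ φ.source) ∧
      ‖φ (flow X z.1 z.2) - φ z.2 - z.1 • modelField X p‖ ≤ 1 / (2 * (‖ℓ‖ + 1)) * |z.1| :=
    ((hflow.eventually_mem hW).and (hflow.eventually_mem (extChartAt_source_mem_nhds p))).and
      (eventually_norm_chart_flow_sub_le hX p hη)
  rw [nhds_prod_eq] at hgood
  obtain ⟨P, hP, Q, hQ, hPQ⟩ := eventually_prod_iff.1 hgood
  obtain ⟨δ', hδ', hδP'⟩ := Metric.eventually_nhds_iff_ball.1 hP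
  set δ := δ' / 2 with hδdef
  have hδ : 0 < δ := half_pos hδ'
  have hδP : ∀ s ∈ Icc (-δ) δ, P s := fun s hs ↦ hδP' s (by
    rw [mem_ball_zero_iff, Real.norm_eq_abs]
    exact (abs_le.2 hs).trans_lt (half_lt_self hδ'))
  have hsmall : ∀ᶠ q in 𝓝 p, |ℓ (φ q - φ p)| < δ / 2 := by
    have : Tendsto (fun q ↦ |ℓ (φ q - φ p)|) (𝓝 p) (𝓝 0) := by
      have h1 : Tendsto (fun q ↦ φ q - φ p) (𝓝 p) (𝓝 0) := by
        rw [← sub_self (φ p)]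
        exact (continuousAt_extChartAt (I := 𝓡 d) p).tendsto.sub_const (φ p)
      have h2 := ((ℓ.continuous.tendsto _).comp h1).abs
      rw [map_zero, abs_zero] at h2
      exact h2
    exact this.eventually (gt_mem_nhds (half_pos hδ))
  filter_upwards [hQ, hsmall] with q hq hqs
  have hest : ∀ s ∈ Icc (-δ) δ, |ℓ (φ (flow X s q) - φ p) - ℓ (φ q - φ p) - s| ≤ |s| / 2 := by
    intro s hs
    have h1 := (hPQ (hδP s hs) hq).2
    have h2 : ℓ (φ (flow X s q) - φ p) - ℓ (φ q - φ p) - s =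
        ℓ (φ (flow X s q) - φ q - s • modelField X p) := by
      simp only [map_sub, map_smul, hℓ, smul_eq_mul, mul_one]
      ring
    rw [h2, ← Real.norm_eq_abs]
    calc _ ≤ ‖ℓ‖ * (1 / (2 * (‖ℓ‖ + 1)) * |s|) := ℓ.le_of_opNorm_le_of_le le_rfl h1
      _ = ‖ℓ‖ / (‖ℓ‖ + 1) * (|s| / 2) := by field_simp
      _ ≤ 1 * (|s| / 2) := by
        gcongr
        rw [div_le_one (by positivity)]
        linarith
      _ = |s| / 2 := one_mul _
  have hcont : ContinuousOn (fun s ↦ ℓ (φ (flow X s q) - φ p)) (Icc (-δ) δ) := by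
    intro s hs
    refine ContinuousAt.continuousWithinAt ?_
    refine ℓ.continuous.continuousAt.comp (ContinuousAt.sub ?_ continuousAt_const)
    exact ContinuousAt.comp (f := fun s ↦ flow X s q) (g := φ)
      (continuousAt_extChartAt' (hPQ (hδP s hs) hq).1.2) (continuous_flow_time hX q).continuousAt
  have hpos := hest δ ⟨by linarith, le_rfl⟩
  have hneg := hest (-δ) ⟨le_rfl, by linarith⟩
  rw [abs_neg, abs_of_pos hδ, abs_le] at hneg
  rw [abs_of_pos hδ, abs_le] at hpos
  rw [abs_lt] at hqs
  -- Up to an error `δ / 2`, the function moves by `±δ` from a starting value below `δ / 2` in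
  -- absolute value, so it changes sign.
  obtain ⟨s, hs, hs0⟩ := intermediate_value_Icc (by linarith : -δ ≤ δ) hcont
    (show (0 : ℝ) ∈ Icc (ℓ (φ (flow X (-δ) q) - φ p)) (ℓ (φ (flow X δ q) - φ p)) from
      ⟨by linarith [hneg.2, hqs.2], by linarith [hpos.1, hqs.1]⟩)
  exact ⟨s, (hPQ (hδP s hs) hq).1.1, hs0⟩

end Transverse

/-! ### Existence and invariance of limit times. -/

section LimitTime

variable {d : ℕ} {M : Type*} [TopologicalSpace M] [T2Space M] [CompactSpace M]
  [ChartedSpace (EuclideanSpace ℝ (Fin d)) M] [IsManifold (𝓡 d) ∞ M]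
  {X : ∀ x : M, TangentSpace (𝓡 d) x} {f : M → M} {T : ℝ}

/-- `τ` is a time with `f p = X_τ(p)` to which all times `t ∈ [-T, T]` with `f q = X_t(q)` converge
as `q` tends to `p` outside the orbit of `p`. -/
def IsLimitTime (X : ∀ x : M, TangentSpace (𝓡 d) x) (f : M → M) (T : ℝ) (p : M) (τ : ℝ) : Prop :=
  τ ∈ Icc (-T) T ∧ f p = flow X τ p ∧ ∀ ε > 0, ∀ᶠ q in 𝓝 p, q ∉ orbit X p →
    ∀ t ∈ Icc (-T) T, f q = flow X t q → |t - τ| < ε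

theorem flow_mem_orbit_iff (hX : IsC1VectorField X) {s : ℝ} {p q : M} :
    flow X s q ∈ orbit X p ↔ q ∈ orbit X p := by
  constructor
  · rintro ⟨r, -, hr⟩
    refine ⟨-s + r, mem_univ _, ?_⟩
    have hr : flow X r p = flow X s q := hr
    change flow X (-s + r) p = q
    rw [flow_add hX, hr, flow_neg_flow hX]
  · rintro ⟨r, -, rfl⟩
    exact ⟨s + r, mem_univ _, flow_add hX s r p⟩

theorem eq_flow_of_tendsto (hX : IsC1VectorField X) (hfc : Continuous f) {p : M} {q : ℕ → M}
    (hq : Tendsto q atTop (𝓝 p)) {t : ℕ → ℝ} {t₀ : ℝ} (ht : Tendsto t atTop (𝓝 t₀))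
    (hfq : ∀ n, f (q n) = flow X (t n) (q n)) : f p = flow X t₀ p := by
  have h1 : Tendsto (fun n ↦ f (q n)) atTop (𝓝 (f p)) := (hfc.tendsto p).comp hq
  have h2 : Tendsto (fun n ↦ flow X (t n) (q n)) atTop (𝓝 (flow X t₀ p)) :=
    ((continuous_flow hX).tendsto (t₀, p)).comp (ht.prodMk_nhds hq)
  simp only [hfq] at h1
  exact tendsto_nhds_unique h1 h2

/-- Since `f` commutes with the flow, sliding a point along its orbit keeps its displacement times.
Hence a sequence violating convergence may be moved into the hyperplane `ℓ = 0`, and a subsequence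
has convergent times. -/
theorem isLimitTime_of_forall_seq (hX : IsC1VectorField X) (hfc : Continuous f)
    (hf : ∀ t x, f (flow X t x) = flow X t (f x)) {p : M} {τ : ℝ} (hτ : τ ∈ Icc (-T) T)
    (hfp : f p = flow X τ p) {ℓ : EuclideanSpace ℝ (Fin d) →L[ℝ] ℝ}
    (hℓ : ∀ W ∈ 𝓝 p, ∀ᶠ q in 𝓝 p, ∃ s, flow X s q ∈ W ∧
        ℓ (extChartAt (𝓡 d) p (flow X s q) - extChartAt (𝓡 d) p p) = 0)
    (h : ∀ (q : ℕ → M) (t : ℕ → ℝ) (t₀ : ℝ), Tendsto q atTop (𝓝 p) → (∀ n, q n ∉ orbit X p) →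
      (∀ n, ℓ (extChartAt (𝓡 d) p (q n) - extChartAt (𝓡 d) p p) = 0) →
      (∀ n, f (q n) = flow X (t n) (q n)) → Tendsto t atTop (𝓝 t₀) → f p = flow X t₀ p →
      t₀ = τ) : IsLimitTime X f T p τ := by
  refine ⟨hτ, hfp, fun ε hε ↦ ?_⟩
  by_contra hcon
  have hfreq : ∃ᶠ q in 𝓝 p, q ∉ orbit X p ∧ ∃ t ∈ Icc (-T) T, f q = flow X t q ∧ ε ≤ |t - τ| := by
    refine (not_eventually.1 hcon).mono fun q hq ↦ ?_
    push Not at hq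
    exact hq
  have hfreq' : ∃ᶠ q in 𝓝 p, q ∉ orbit X p ∧
      ℓ (extChartAt (𝓡 d) p q - extChartAt (𝓡 d) p p) = 0 ∧
      ∃ t ∈ Icc (-T) T, f q = flow X t q ∧ ε ≤ |t - τ| := by
    rw [frequently_iff]
    intro W hW
    obtain ⟨q, ⟨hq, t, ht, hfq, hε⟩, s, hs, hs0⟩ := (hfreq.and_eventually (hℓ W hW)).exists
    refine ⟨flow X s q, hs, fun h ↦ hq ((flow_mem_orbit_iff hX).1 h), hs0, t, ht, ?_, hε⟩
    rw [hf, hfq, flow_comm hX]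
  have : SecondCountableTopology M :=
    ChartedSpace.secondCountable_of_sigmaCompact (EuclideanSpace ℝ (Fin d)) M
  obtain ⟨q, hq, hq'⟩ := exists_seq_forall_of_frequently hfreq'
  choose hqo hq0 t ht hfq hεt using hq'
  obtain ⟨t₀, -, σ, hσ, hlim⟩ := isCompact_Icc.tendsto_subseq ht
  have hqσ := hq.comp hσ.tendsto_atTop
  have hft := eq_flow_of_tendsto hX hfc hqσ hlim fun n ↦ hfq (σ n)
  have heq := h (q ∘ σ) (t ∘ σ) t₀ hqσ (fun n ↦ hqo _) (fun n ↦ hq0 _) (fun n ↦ hfq _) hlim hft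
  have hle : ε ≤ |t₀ - τ| :=
    ge_of_tendsto' (hlim.sub_const τ).abs fun n ↦ hεt (σ n)
  rw [heq, sub_self, abs_zero] at hle
  exact absurd hle (not_le.2 hε)

theorem exists_isLimitTime_of_aperiodic (hX : IsC1VectorField X) (hfc : Continuous f)
    (hf : ∀ t x, f (flow X t x) = flow X t (f x))
    (hT : ∀ p, ∃ t ∈ Icc (-T) T, f p = flow X t p) {p : M}
    (hp : ∀ h, flow X h p = p → h = 0) : ∃ τ, IsLimitTime X f T p τ := by
  obtain ⟨τ, hτ, hfp⟩ := hT p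
  obtain ⟨ℓ, -, hℓ⟩ := exists_transversal hX p
  refine ⟨τ, isLimitTime_of_forall_seq hX hfc hf hτ hfp hℓ ?_⟩
  intro q t t₀ _ _ _ _ _ ht₀
  rw [hfp] at ht₀
  have := hp (-τ + t₀) (by rw [flow_add hX, ← ht₀, flow_neg_flow hX])
  linarith

/-- If the flow direction spans the tangent space at `p`, the orbit of `p` is a neighbourhood of
`p`. -/
theorem orbit_mem_nhds (hX : IsC1VectorField X) {p : M}
    (hp : Submodule.span ℝ {modelField X p} = ⊤) : orbit X p ∈ 𝓝 p := by
  obtain ⟨ℓ, hℓ, htr⟩ := exists_transversal hX p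
  filter_upwards [htr _ (extChartAt_source_mem_nhds (I := 𝓡 d) p)] with q ⟨s, hs, hs0⟩
  have h0 := hℓ _ (hp ▸ Submodule.mem_top) hs0
  have h1 := (extChartAt (𝓡 d) p).injOn hs (mem_extChartAt_source p) (sub_eq_zero.1 h0)
  rw [← flow_mem_orbit_iff hX (s := s), h1]
  exact mem_orbit_self hX p

theorem exists_isLimitTime_of_hyperbolic
    [RiemannianBundle (fun x : M ↦ TangentSpace (𝓡 d) x)]
    [IsContMDiffRiemannianBundle (𝓡 d) ∞ (EuclideanSpace ℝ (Fin d))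
      (fun x : M ↦ TangentSpace (𝓡 d) x)]
    (hX : IsC1VectorField X) (hfd : MDifferentiable (𝓡 d) (𝓡 d) f)
    (hf : ∀ t x, f (flow X t x) = flow X t (f x))
    (hT : ∀ p, ∃ t ∈ Icc (-T) T, f p = flow X t p) {p : M}
    (hhyp : IsHyperbolicSet X (orbit X p)) : ∃ τ, IsLimitTime X f T p τ := by
  obtain ⟨c, hc, hfp⟩ := hT p
  by_cases htop : Submodule.span ℝ {modelField X p} = ⊤
  -- Here the orbit of `p` is a neighbourhood of `p`, so the convergence condition is vacuous and
  -- any admissible time works.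
  · refine ⟨c, hc, hfp, fun ε _ ↦ ?_⟩
    filter_upwards [orbit_mem_nhds hX htop] with q hq hq'
    exact absurd hq hq'
  have hfc : Continuous f := hfd.continuous
  have hd := mdifferentiableAt_flow_of_isHyperbolicSet hX hhyp htop
  have hd0 : ∀ s, MDifferentiableAt (𝓡 d) (𝓡 d) (flow X s) p := fun s ↦ by
    simpa [flow_zero hX] using hd s 0
  set L := Submodule.span ℝ {modelField X p} with hL
  set φ := extChartAt (𝓡 d) p with hφ
  let g : M → M := flow X (-c) ∘ f
  have hgp : g p = p := by
    change flow X (-c) (f p) = p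
    rw [hfp, flow_neg_flow hX]
  have hg : MDifferentiableAt (𝓡 d) (𝓡 d) g p := by
    refine MDifferentiableAt.comp p ?_ (hfd p)
    rw [hfp]
    exact hd _ _
  have hgcomm : ∀ t x, g (flow X t x) = flow X t (g x) := by
    intro t x
    change flow X (-c) (f (flow X t x)) = flow X t (flow X (-c) (f x))
    rw [hf, flow_comm hX]
  have hgt : ∀ {t x}, f x = flow X t x → g x = flow X (t - c) x := by
    intro t x h
    change flow X (-c) (f x) = _
    rw [h, ← flow_add hX, sub_eq_neg_add]
  have hret : ∀ {t}, f p = flow X t p → flow X (t - c) p = p := fun h ↦ by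
    rw [← hgt h, hgp]
  have hinvL : ∀ {k : M → M}, MDifferentiableAt (𝓡 d) (𝓡 d) k p →
      (∀ t, k (flow X t p) = flow X t (k p)) → k p = p → ∀ v ∈ L, modelDeriv k p v ∈ L := by
    intro k hk hkc hkp v hv
    obtain ⟨r, rfl⟩ := Submodule.mem_span_singleton.1 hv
    rw [map_smul, modelDeriv_modelField hX hk hkc, hkp]
    exact Submodule.smul_mem _ _ (Submodule.mem_span_singleton_self _)
  have hΦadd : ∀ a b, flow X b p = p → ∀ v : EuclideanSpace ℝ (Fin d),
      modelDeriv (flow X a) p (modelDeriv (flow X b) p v) =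
      modelDeriv (flow X (a + b)) p v := by
    intro a b hb v
    rw [modelDeriv_flow_add hX (hd a b) (hd0 b), hb]
  have hneg : ∀ {a}, flow X a p = p → flow X (-a) p = p := fun {a} ha ↦ by
    conv_lhs => rw [← ha]
    exact flow_neg_flow hX a p
  have hfix : ∀ a, flow X a p = p → a ≠ 0 → ∀ v, modelDeriv (flow X a) p v - v ∈ L → v ∈ L :=
    fun a ha ha0 v hv ↦ mem_span_of_isHyperbolicSet hX hhyp htop ha0 ha hv
  -- Approach `p` along the ray in direction `v` and extract a limit of displacement times; the
  -- rescaling `n + 1` recovers `v`. Recording `a + c ∈ [-T, T]` keeps the final limit time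
  -- admissible.
  have hex : ∀ v, ∃ a ∈ {a | flow X a p = p ∧ a + c ∈ Icc (-T) T},
      modelDeriv g p v - modelDeriv (flow X a) p v ∈ L := by
    intro v
    let r : ℕ → ℝ := fun n ↦ 1 / ((n : ℝ) + 1)
    have hr : Tendsto r atTop (𝓝 0) := tendsto_one_div_add_atTop_nhds_zero_nat
    have hx : Tendsto (fun n ↦ φ p + r n • v) atTop (𝓝 (φ p)) := by
      simpa using (hr.smul_const v).const_add (φ p)
    let q : ℕ → M := fun n ↦ φ.symm (φ p + r n • v)
    have hq : Tendsto q atTop (𝓝 p) := by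
      have := (continuousAt_extChartAt_symm (I := 𝓡 d) p).tendsto.comp hx
      rwa [extChartAt_to_inv] at this
    choose t ht hft using fun n ↦ hT (q n)
    obtain ⟨t₀, ht₀, σ, hσ, hlim⟩ := isCompact_Icc.tendsto_subseq ht
    have hqσ := hq.comp hσ.tendsto_atTop
    have hfpt := eq_flow_of_tendsto hX hfc hqσ hlim fun n ↦ hft (σ n)
    refine ⟨t₀ - c, ⟨hret hfpt, by simpa using ht₀⟩, ?_⟩
    refine modelDeriv_sub_mem_span hX hg hgp (hret hfpt) (hd0 _) hqσ (hlim.sub_const c)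
      (fun n ↦ hgt (hft (σ n))) (c := fun n ↦ (σ n : ℝ) + 1) ?_
    refine tendsto_const_nhds.congr' ?_
    filter_upwards [(hx.comp hσ.tendsto_atTop).eventually_mem (extChartAt_target_mem_nhds p)]
      with n hn
    have h1 : φ (q (σ n)) = φ p + r (σ n) • v := φ.right_inv hn
    have h2 : ((σ n : ℝ) + 1) * r (σ n) = 1 := mul_one_div_cancel (by positivity)
    change v = ((σ n : ℝ) + 1) • (φ (q (σ n)) - φ p)
    rw [h1, add_sub_cancel_left, smul_smul, h2, one_smul]
  obtain ⟨a, ⟨haH, haT⟩, ha⟩ := exists_forall_sub_mem L {a | flow X a p = p}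
    (fun t ↦ (modelDeriv (flow X t) p).toLinearMap) (modelDeriv g p).toLinearMap
    (fun a ha b hb ↦ by
      change flow X (a - b) p = p
      rw [sub_eq_add_neg, flow_add hX, hneg hb, ha])
    (fun a _ b hb v ↦ hΦadd a b hb v) (fun v ↦ modelDeriv_flow_zero hX p v)
    (fun a ha ↦ hinvL (hd0 a) (fun t ↦ flow_comm hX a t p) ha)
    (hinvL hg (fun t ↦ hgcomm t p) hgp)
    (fun a ha v ↦ by
      have ha : flow X a p = p := ha
      have h1 : modelDeriv (g ∘ flow X a) p v = modelDeriv g p (modelDeriv (flow X a) p v) := by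
        rw [modelDeriv_comp (by rwa [ha]) (hd0 a), ha]
      have h2 : modelDeriv (flow X a ∘ g) p v = modelDeriv (flow X a) p (modelDeriv g p v) := by
        rw [modelDeriv_comp (by rw [hgp]; exact hd0 a) hg, hgp]
      have h3 : g ∘ flow X a = flow X a ∘ g := funext fun x ↦ hgcomm a x
      change modelDeriv g p (modelDeriv (flow X a) p v) = modelDeriv (flow X a) p (modelDeriv g p v)
      rw [← h1, ← h2, h3])
    hfix (fun a ha ↦ ha.1) hex htop
  have ha : ∀ v, modelDeriv g p v - modelDeriv (flow X a) p v ∈ L := ha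
  obtain ⟨ℓ, hℓ, htr⟩ := exists_transversal hX p
  refine ⟨a + c, isLimitTime_of_forall_seq hX hfc hf haT ?_ htr ?_⟩
  · rw [add_comm, flow_add hX, haH, hfp]
  intro q t t₀ hq hqo hq0 hfq ht hfpt
  -- Unit directions in the hyperplane `ℓ = 0` accumulate at a unit vector `v` with `ℓ v = 0`, hence
  -- outside `L`. Being off the orbit ensures `q n ≠ p`.
  let u : ℕ → EuclideanSpace ℝ (Fin d) := fun n ↦ ‖φ (q n) - φ p‖⁻¹ • (φ (q n) - φ p)
  have hu : ∀ n, u n ∈ closedBall (0 : EuclideanSpace ℝ (Fin d)) 1 := by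
    intro n
    rw [mem_closedBall_zero_iff, norm_smul, norm_inv, norm_norm]
    exact inv_mul_le_one
  have hu1 : ∀ᶠ n in atTop, ‖u n‖ = 1 := by
    filter_upwards [hq.eventually_mem (extChartAt_source_mem_nhds (I := 𝓡 d) p)] with n hn
    have hne : φ (q n) - φ p ≠ 0 := by
      intro h0
      have h1 := φ.injOn hn (mem_extChartAt_source p) (sub_eq_zero.1 h0)
      exact hqo n (h1 ▸ mem_orbit_self hX p)
    rw [norm_smul, norm_inv, norm_norm, inv_mul_cancel₀ (norm_ne_zero_iff.2 hne)]
  have hu0 : ∀ n, ℓ (u n) = 0 := fun n ↦ by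
    rw [map_smul, hq0 n, smul_zero]
  obtain ⟨v, -, σ, hσ, hlim⟩ := (isCompact_closedBall _ _).tendsto_subseq hu
  have hv1 : ‖v‖ = 1 := tendsto_nhds_unique hlim.norm
    (tendsto_const_nhds.congr' ((hσ.tendsto_atTop.eventually hu1).mono fun n hn ↦ hn.symm))
  have hv0 : ℓ v = 0 := tendsto_nhds_unique ((ℓ.continuous.tendsto v).comp hlim)
    (tendsto_const_nhds.congr fun n ↦ (hu0 (σ n)).symm)
  have hvL : v ∉ L := fun hv ↦ by
    rw [hℓ v hv hv0, norm_zero] at hv1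
    exact zero_ne_one hv1
  have hmem := modelDeriv_sub_mem_span hX hg hgp (hret hfpt) (hd0 _) (hq.comp hσ.tendsto_atTop)
    ((ht.comp hσ.tendsto_atTop).sub_const c) (fun n ↦ hgt (hfq (σ n)))
    (c := fun n ↦ ‖φ (q (σ n)) - φ p‖⁻¹) hlim
  by_contra hne
  have hmem' : modelDeriv (flow X (t₀ - c)) p v - modelDeriv (flow X a) p v ∈ L := by
    have := L.sub_mem (ha v) hmem
    rwa [sub_sub_sub_cancel_left] at this
  -- If `t₀ ≠ a + c`, then `DX_a v` is fixed modulo `L` by the derivative at the nonzero return time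
  -- `t₀ - c - a`, so it lies in `L`; applying `DX_{-a}` puts `v` in `L`.
  have hsplit : modelDeriv (flow X (t₀ - c - a)) p (modelDeriv (flow X a) p v) =
      modelDeriv (flow X (t₀ - c)) p v := by
    rw [hΦadd _ _ haH, sub_add_cancel]
  rw [← hsplit] at hmem'
  have hav := hfix (t₀ - c - a) (by rw [sub_eq_add_neg (t₀ - c), flow_add hX, hneg haH, hret hfpt])
    (fun h0 ↦ hne (by linarith)) _ hmem'
  have := hinvL (hd0 (-a)) (fun t ↦ flow_comm hX (-a) t p) (hneg haH) _ hav
  rw [hΦadd _ _ haH, neg_add_cancel, modelDeriv_flow_zero hX] at this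
  exact hvL this

theorem isLimitTime_flow (hX : IsC1VectorField X)
    (hf : ∀ t x, f (flow X t x) = flow X t (f x)) {p : M} {τ : ℝ} (h : IsLimitTime X f T p τ)
    (s : ℝ) : IsLimitTime X f T (flow X s p) τ := by
  obtain ⟨h1, h2, h3⟩ := h
  refine ⟨h1, by rw [hf, h2, flow_comm hX], fun ε hε ↦ ?_⟩
  have hc : Tendsto (flow X (-s)) (𝓝 (flow X s p)) (𝓝 p) := by
    have := (continuous_flow_space hX (-s)).tendsto (flow X s p)
    rwa [flow_neg_flow hX] at this
  filter_upwards [hc.eventually (h3 ε hε)] with q hq hqo t ht hfq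
  refine hq (fun hmem ↦ hqo ?_) t ht (by rw [hf, hfq, flow_comm hX])
  obtain ⟨r, -, hr⟩ := (flow_mem_orbit_iff hX).1 hmem
  refine ⟨r - s, mem_univ _, ?_⟩
  change flow X (r - s) (flow X s p) = q
  rw [← flow_add hX, sub_add_cancel]
  exact hr

end LimitTime

end VectorFieldFlow

end

/-! ### Gluing the limit times into a continuous invariant function. -/

open VectorFieldFlow

theorem mainTheorem2 {d : ℕ} {M : Type*} [TopologicalSpace M] [T2Space M] [CompactSpace M]
    [ChartedSpace (EuclideanSpace ℝ (Fin d)) M] [IsManifold (𝓡 d) ∞ M]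
    [RiemannianBundle (fun x : M ↦ TangentSpace (𝓡 d) x)]
    [IsContMDiffRiemannianBundle (𝓡 d) ∞ (EuclideanSpace ℝ (Fin d))
      (fun x : M ↦ TangentSpace (𝓡 d) x)]
    (X : ∀ x : M, TangentSpace (𝓡 d) x)
    (hX : VectorFieldFlow.IsC1VectorField X)
    (hhyp : VectorFieldFlow.AllCriticalOrbitsHyperbolic X)
    (f : M ≃ₘ^1⟮𝓡 d, 𝓡 d⟯ M)
    (hf : f ∈ VectorFieldFlow.diffCentralizer X)
    (hT : ∃ T : ℝ, 0 < T ∧ ∀ p : M, f p ∈ VectorFieldFlow.orbitPiece X (Icc (-T) T) p) :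
    ∃ τ : M → ℝ, Continuous τ ∧ VectorFieldFlow.IsInvariantFunction X τ ∧
      ∀ p : M, f p = VectorFieldFlow.flow X (τ p) p := by
  obtain ⟨T, -, hT⟩ := hT
  have hT' : ∀ p, ∃ t ∈ Icc (-T) T, f p = flow X t p := fun p ↦ by
    obtain ⟨t, ht, h⟩ := hT p
    exact ⟨t, ht, h.symm⟩
  have hfd : MDifferentiable (𝓡 d) (𝓡 d) f := f.contMDiff.mdifferentiable one_ne_zero
  have hex : ∀ p, ∃ τ, IsLimitTime X f T p τ := by
    intro p
    by_cases hp : ∀ h, flow X h p = p → h = 0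
    · exact exists_isLimitTime_of_aperiodic hX f.continuous hf hT' hp
    · push Not at hp
      obtain ⟨h, hhp, hh⟩ := hp
      refine exists_isLimitTime_of_hyperbolic hX hfd hf hT' (hhyp p ?_)
      by_cases hXp : X p = 0
      · exact Or.inr hXp
      · refine Or.inl ⟨hXp, |h|, abs_pos.2 hh, ?_⟩
        rcases abs_choice h with h' | h' <;> rw [h']
        · exact hhp
        · conv_lhs => rw [← hhp]
          exact flow_neg_flow hX h p
  have hsets : ∀ t p, {τ | IsLimitTime X f T (flow X t p) τ} = {τ | IsLimitTime X f T p τ} := by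
    intro t p
    ext τ
    refine ⟨fun h ↦ ?_, fun h ↦ isLimitTime_flow hX hf h t⟩
    have := isLimitTime_flow hX hf h (-t)
    rwa [flow_neg_flow hX] at this
  -- Limit times need not be unique when an orbit is open. Choosing from the set of limit times,
  -- which is the same along an orbit, rather than from the point makes `τ` invariant.
  let pick : Set ℝ → ℝ := fun S ↦ Classical.epsilon (· ∈ S)
  let τ : M → ℝ := fun p ↦ pick {τ | IsLimitTime X f T p τ}
  have hτ : ∀ p, IsLimitTime X f T p (τ p) := fun p ↦ Classical.epsilon_spec (hex p)
  have hinv : IsInvariantFunction X τ := fun t p ↦ congrArg pick (hsets t p)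
  refine ⟨τ, continuous_iff_continuousAt.2 fun p ↦ ?_, hinv, fun p ↦ (hτ p).2.1⟩
  rw [Metric.continuousAt_iff']
  intro ε hε
  filter_upwards [(hτ p).2.2 ε hε] with q hq
  -- Limit times say nothing about nearby points of the same orbit; there invariance gives equality.
  by_cases hqo : q ∈ orbit X p
  · obtain ⟨s, -, rfl⟩ := hqo
    rw [hinv s p, dist_self]
    exact hε
  · exact hq hqo (τ q) (hτ q).1 (hτ q).2.1
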